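/- Let $M^2$ be a smooth surface and $\mathbf g : M^2 \to \mathbb S^5 \subset \mathbb R^6$ a smooth minimal immersion whose second fundamental form $B$ vanishes at no point, i.e. $B_p \neq 0$ for every $p \in M$. Let $$\mathcal N=\{(p,V)\in M\times\mathbb R^6 : \|V\|=1,\ V\perp \mathbb R\,\mathbf g(p)\oplus \mathbf g_*(T_pM)\}$$ be the unit normal bundle of $\mathbf g$ in $\mathbb S^5$, and let $$\mathcal N_*=\{(p,V)\in\mathcal N : \langle V, B_p(X,Y)\rangle\neq 0 \text{ for some } X,Y\in T_pM\},$$ that is, from each fibre of $\mathcal N$ the unit normals orthogonal to the image of $B_p$ are removed. Then $\mathcal N_*$ is open in $\mathcal N$ and is a smooth $4$-dimensional embedded submanifold of $M\times\mathbb R^6$, and the map $$\mathbf x_{\mathbf g}:\mathcal N_*\to\mathbb S^5,\qquad \mathbf x_{\mathbf g}(p,V)=V,$$ is an immersion. Moreover $\mathbf x_{\mathbf g}$ is a minimal immersed hypersurface of $\mathbb S^5$ whose Gauss–Kronecker curvature $H_4=\lambda_1\lambda_2\lambda_3\lambda_4$ and $3$-mean curvature $H_3=\frac14\sum_{i<j<k}\lambda_i\lambda_j\lambda_k$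 vanish identically, where $\lambda_1,\dots,\lambda_4$ are the principal curvatures of $\mathbf x_{\mathbf g}$ with respect to a unit normal vector (tangent to $\mathbb S^5$). -/

import Mathlib

open scoped Manifold ContDiff InnerProductSpace

noncomputable section

/-- Euclidean space `ℝ⁶`. -/
abbrev E6 : Type := EuclideanSpace ℝ (Fin 6)

/-- The unit sphere `S⁵ ⊂ ℝ⁶`, with Mathlib's manifold structure. -/
abbrev S5 : Type := Metric.sphere (0 : E6) 1

namespace SphereImmersion

section General

variable (n : ℕ) {M : Type*} [TopologicalSpace M] [ChartedSpace (EuclideanSpace ℝ (Fin n)) M]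

/-- The differential `df_p : T_pM → ℝ⁶` of `f : M → S⁵ ⊂ ℝ⁶`. -/
def differential (f : M → S5) (p : M) : TangentSpace (𝓡 n) p →L[ℝ] E6 :=
  mfderiv (𝓡 n) 𝓘(ℝ, E6) (fun x => (f x : E6)) p

/-- The normal space `(f_* T_pM)^⊥` of `f` in `S⁵` at `p`: the vectors of `ℝ⁶` that are tangent
to `S⁵` at `f p` and orthogonal to `df_p(T_pM)`. -/
def normalSpace (f : M → S5) (p : M) : Submodule ℝ E6 :=
  ((ℝ ∙ (f p : E6)) ⊔ (differential n f p).range)ᗮ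

/-- The second fundamental form `B_p(X, Y)` of `f : M → S⁵`: the component in `normalSpace n f p`
of the derivative along `X` of `df(Y)`, where `Y` is extended to a vector field with constant
coordinates in the preferred chart at `p` (the chart through which Mathlib identifies `T_pM` with
`ℝⁿ`).  The normal component does not depend on the extension. -/
def secondFundamentalForm (f : M → S5) (p : M) (X Y : TangentSpace (𝓡 n) p) : E6 :=
  (normalSpace n f p).starProjection
    (fderiv ℝ (fderiv ℝ (fun u : EuclideanSpace ℝ (Fin n) =>
      (f ((extChartAt (𝓡 n) p).symm u) : E6))) (extChartAt (𝓡 n) p p) X Y)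

/-- The `i`-th coordinate vector of `T_pM` in the preferred chart at `p`. -/
def coordVec (p : M) (i : Fin n) : TangentSpace (𝓡 n) p :=
  (EuclideanSpace.single i (1 : ℝ) : EuclideanSpace ℝ (Fin n))

/-- The matrix of the first fundamental form (the induced metric) in the coordinate basis. -/
def firstFormMatrix (f : M → S5) (p : M) : Matrix (Fin n) (Fin n) ℝ :=
  Matrix.of fun i j =>
    ⟪differential n f p (coordVec n p i), differential n f p (coordVec n p j)⟫_ℝ

/-- The mean curvature vector `(1/n) tr B_p`, the trace being taken with respect to the induced
metric. -/
def meanCurvatureVector (f : M → S5) (p : M) : E6 :=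
  (1 / (n : ℝ)) • ∑ i, ∑ j,
    (firstFormMatrix n f p)⁻¹ i j • secondFundamentalForm n f p (coordVec n p i) (coordVec n p j)

/-- A minimal immersion `f : M → S⁵`: a smooth immersion whose mean curvature vanishes
identically. -/
def IsMinimalImmersion (f : M → S5) : Prop :=
  Manifold.IsImmersion (𝓡 n) (𝓡 5) ∞ f ∧ ∀ p, meanCurvatureVector n f p = 0

/-- The matrix in the coordinate basis of the shape operator of `f` at `p` in the normal
direction `ν`, that is, of the endomorphism `A` of `T_pM` with
`⟪df_p(A X), df_p(Y)⟫ = ⟪B_p(X, Y), ν⟫`. -/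
def shapeMatrix (f : M → S5) (p : M) (ν : E6) : Matrix (Fin n) (Fin n) ℝ :=
  (firstFormMatrix n f p)⁻¹ * Matrix.of fun i j =>
    ⟪secondFundamentalForm n f p (coordVec n p i) (coordVec n p j), ν⟫_ℝ

/-- The principal curvatures of `f` at `p` in the direction `ν`: the eigenvalues of the shape
operator, with multiplicity. -/
def principalCurvatures (f : M → S5) (p : M) (ν : E6) : Multiset ℝ :=
  (shapeMatrix n f p ν).charpoly.roots

/-- The `r`-mean curvature `H_r = C(n, r)⁻¹ ∑_{i₁ < ⋯ < i_r} λ_{i₁} ⋯ λ_{i_r}` of `f` at `p` with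
respect to the unit normal `ν`. -/
def rMeanCurvature (r : ℕ) (f : M → S5) (p : M) (ν : E6) : ℝ :=
  (principalCurvatures n f p ν).esymm r / (n.choose r : ℝ)

/-- The Gauss–Kronecker curvature: the product `H_n` of the principal curvatures. -/
def gaussKroneckerCurvature (f : M → S5) (p : M) (ν : E6) : ℝ :=
  rMeanCurvature n n f p ν

end General

section Surface

variable {M : Type*} [TopologicalSpace M] [ChartedSpace (EuclideanSpace ℝ (Fin 2)) M]

/-- The unit normal bundle `N ⊂ M × ℝ⁶` of `g : M² → S⁵`. -/
def unitNormalBundle (g : M → S5) : Set (M × E6) :=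
  {q | ‖q.2‖ = 1 ∧ q.2 ∈ normalSpace 2 g q.1}

/-- The linear span of the image of the second fundamental form at `p`. -/
def secondFormImage (g : M → S5) (p : M) : Submodule ℝ E6 :=
  Submodule.span ℝ {w | ∃ X Y : TangentSpace (𝓡 2) p, w = secondFundamentalForm 2 g p X Y}

/-- The subset `N_*` of the unit normal bundle: from each fibre, the unit normals orthogonal to the
image of the second fundamental form are removed. -/
def starBundle (g : M → S5) : Set (M × E6) :=
  {q | q ∈ unitNormalBundle g ∧ q.2 ∉ (secondFormImage g q.1)ᗮ}

/-- The map `x_g : N_* → S⁵`, `x_g(p, V) = V`. -/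
def polarMap (g : M → S5) (q : starBundle g) : S5 :=
  ⟨q.1.2, mem_sphere_zero_iff_norm.2 q.2.1.1⟩

end Surface

end SphereImmersion

end

open SphereImmersion

/-! In a chart of `M` let `G` be the surface, and let `V` be its unit normal field, depending on the
two base coordinates and two fibre coordinates; `π` forgets the fibre coordinates. Put `h(a, b) =
⟪V, d²G(a, b)⟫`, the second fundamental form in the direction `V`. Differentiating `⟪V, G⟫ = 0` and
`⟪V, dG⟫ = 0` gives `⟪dV, G⟫ = 0`, `⟪dV X, dG a⟫ = -h(πX, a)` and `⟪d²V(X, Y), G⟫ = h(πX, πY)`.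

Minimality makes `h` trace-free, and on `N_*` it is nonzero. A nonzero trace-free symmetric form on
a Euclidean plane is nondegenerate (`det_ne_zero_of_trace_eq_zero`). So `dV X = 0` forces `πX = 0`,
and the fibre part of `X` vanishes because the fibre coordinates are a differentiable function of
`V`: the polar map is an immersion (`IsPolarPair.fderiv_normal_injective`). By dimension its normal
line is spanned by `G`.

Hence its second fundamental form is `h(πX, πY) G`. Fibre directions lie in its kernel, the shape
operator has rank at most two, and `H₃ = H₄ = 0` (`rMeanCurvature_polarMap`). The trace of this form
is `tr(g h⁻¹)`, with `g` the first fundamental form of `G`; for matrices of size two this equals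
`tr(g⁻¹ h) det g / det h`, which vanishes (`trace_polar_eq_zero`). Classically, principal curvatures
`±κ` turn into `±1/κ, 0, 0`.

The smooth structure on `N_*` comes from explicit charts (`starChart`): base coordinates together
with the central projection of the fibre from the origin onto an affine plane. -/

open Set Function Topology

/-! ### Immersions and injectivity of the differential -/

namespace Manifold

section Immersion

variable {E E'' F : Type*} [NormedAddCommGroup E] [NormedSpace ℝ E]
  [NormedAddCommGroup E''] [NormedSpace ℝ E''] [NormedAddCommGroup F] [NormedSpace ℝ F]
  {H G : Type*} [TopologicalSpace H] [TopologicalSpace G]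
  {I : ModelWithCorners ℝ E H} {J : ModelWithCorners ℝ E'' G}
  {M N : Type*} [TopologicalSpace M] [ChartedSpace H M] [TopologicalSpace N] [ChartedSpace G N]
  {n : ℕ∞ω} {f : M → N} {x : M}

/-- The differential of an immersion is injective. -/
theorem IsImmersionAtOfComplement.mfderiv_injective [IsManifold I n M] [IsManifold J n N]
    (hn : n ≠ 0) (h : IsImmersionAtOfComplement F I J n f x) :
    Injective (mfderiv I J f x) := by
  have hn1 : 1 ≤ n := ENat.one_le_iff_ne_zero_withTop.2 hn
  have : IsManifold I 1 M := .of_le hn1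
  have : IsManifold J 1 N := .of_le hn1
  have hf : MDifferentiableAt I J f x := h.contMDiffAt.mdifferentiableAt hn
  have hφ : h.domChart.MDifferentiable I I :=
    ⟨(contMDiffOn_of_mem_maximalAtlas h.domChart_mem_maximalAtlas).mdifferentiableOn hn,
      (contMDiffOn_symm_of_mem_maximalAtlas h.domChart_mem_maximalAtlas).mdifferentiableOn hn⟩
  have hφe : MDifferentiableAt I 𝓘(ℝ, E) (h.domChart.extend I) x :=
    (h.domChart.contMDiffAt_extend h.domChart_mem_maximalAtlas
      h.mem_domChart_source).mdifferentiableAt hn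
  have hψe : MDifferentiableAt J 𝓘(ℝ, E'') (h.codChart.extend J) (f x) :=
    (h.codChart.contMDiffAt_extend h.codChart_mem_maximalAtlas
      h.mem_codChart_source).mdifferentiableAt hn
  have hinj : Injective (mfderiv I 𝓘(ℝ, E) (h.domChart.extend I) x) := by
    have h1 : mfderiv I 𝓘(ℝ, E) (h.domChart.extend I) x
        = (mfderiv I 𝓘(ℝ, E) I (h.domChart x)).comp (mfderiv I I h.domChart x) :=
      mfderiv_comp x I.mdifferentiableAt (hφ.mdifferentiableAt h.mem_domChart_source)
    rw [h1, I.hasMFDerivAt.mfderiv]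
    exact hφ.mfderiv_injective h.mem_domChart_source
  -- In the normal form `u ↦ (u, 0)` the first factor recovers `u`, so `r ∘ codChart ∘ f` agrees
  -- near `x` with the domain chart, whose differential is injective.
  let r : E'' →L[ℝ] E := (ContinuousLinearMap.fst ℝ E F).comp (h.equiv.symm : E'' →L[ℝ] E × F)
  have heq : (r ∘ h.codChart.extend J) ∘ f =ᶠ[𝓝 x] h.domChart.extend I := by
    filter_upwards [h.domChart.open_source.mem_nhds h.mem_domChart_source] with y hy
    have hy' : h.domChart.extend I y ∈ (h.domChart.extend I).target :=
      (h.domChart.extend I).map_source (by simpa using hy)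
    have h2 := h.writtenInCharts hy'
    simp only [comp_apply] at h2
    rw [(h.domChart.extend I).left_inv (by simpa using hy)] at h2
    simp only [comp_apply, h2, r]
    simp
  have h3 := heq.mfderiv_eq (I := I) (I' := 𝓘(ℝ, E))
  have hr : MDifferentiableAt J 𝓘(ℝ, E) (r ∘ h.codChart.extend J) (f x) :=
    (r.mdifferentiableAt).comp _ hψe
  rw [mfderiv_comp x hr hf] at h3
  have : Injective ((mfderiv J 𝓘(ℝ, E) (r ∘ h.codChart.extend J) (f x)).comp
      (mfderiv I J f x)) := by
    rw [h3]; exact hinj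
  exact Injective.of_comp this

/-- The range of `L` has a complement of the dimension of `F`. The model `F` is prescribed because
an immersion is stated relative to one complement shared by all points. -/
theorem exists_complement_equiv [FiniteDimensional ℝ E] [FiniteDimensional ℝ E'']
    [FiniteDimensional ℝ F] (L : E →L[ℝ] E'') (hL : Injective L)
    (hF : Module.finrank ℝ E + Module.finrank ℝ F = Module.finrank ℝ E'') :
    ∃ (ι : F →L[ℝ] E'') (e : (E × F) ≃L[ℝ] E''), ∀ p, e p = L p.1 + ι p.2 := by
  obtain ⟨q, hq⟩ := Submodule.exists_isCompl (L : E →ₗ[ℝ] E'').range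
  have h1 : Module.finrank ℝ (L : E →ₗ[ℝ] E'').range = Module.finrank ℝ E :=
    LinearMap.finrank_range_of_inj hL
  have h2 := Submodule.finrank_add_eq_of_isCompl hq
  have h3 : Module.finrank ℝ F = Module.finrank ℝ q := by omega
  let j : F ≃ₗ[ℝ] q := LinearEquiv.ofFinrankEq _ _ h3
  let e₀ : (E × F) ≃ₗ[ℝ] E'' :=
    ((LinearEquiv.ofInjective (L : E →ₗ[ℝ] E'') hL).prodCongr j).trans
      (Submodule.prodEquivOfIsCompl _ _ hq)
  refine ⟨(q.subtype ∘ₗ (j : F →ₗ[ℝ] q)).toContinuousLinearMap, e₀.toContinuousLinearEquiv,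
    fun p => ?_⟩
  simp [e₀]

/-- Local straightening of a map with injective differential: after composition with a local
diffeomorphism of the target it becomes `u ↦ (u, 0)`. -/
theorem exists_straightening [FiniteDimensional ℝ E] [FiniteDimensional ℝ E'']
    [FiniteDimensional ℝ F] {h : E → E''} {U : Set E} (hU : IsOpen U) {u₀ : E} (hu₀ : u₀ ∈ U)
    (hn : n ≠ 0) (hh : ContDiffOn ℝ n h U) (hinj : Injective (fderiv ℝ h u₀))
    (hF : Module.finrank ℝ E + Module.finrank ℝ F = Module.finrank ℝ E'') :
    ∃ (Θ : OpenPartialHomeomorph E'' E'') (e : (E × F) ≃L[ℝ] E'') (U' : Set E),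
      IsOpen U' ∧ u₀ ∈ U' ∧ U' ⊆ U ∧ ContDiffOn ℝ n Θ Θ.source ∧ ContDiffOn ℝ n Θ.symm Θ.target ∧
      ∀ u ∈ U', h u ∈ Θ.source ∧ Θ (h u) = e (u, 0) := by
  obtain ⟨ι, e, he⟩ := exists_complement_equiv (F := F) (fderiv ℝ h u₀) hinj hF
  -- Adding the complementary directions linearly makes the derivative at `(u₀, 0)` invertible; the
  -- straightening is a local inverse of `Φ` followed by `e`.
  let Φ : E × F → E'' := fun p => h p.1 + ι p.2
  have hΦ : ContDiffOn ℝ n Φ (U ×ˢ univ) :=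
    (hh.comp contDiff_fst.contDiffOn (fun p hp => hp.1)).add
      (ι.contDiff.comp contDiff_snd).contDiffOn
  have hUo : IsOpen (U ×ˢ (univ : Set F)) := hU.prod isOpen_univ
  have hp₀ : ((u₀, 0) : E × F) ∈ U ×ˢ (univ : Set F) := ⟨hu₀, trivial⟩
  have hd : HasFDerivAt Φ (e : E × F →L[ℝ] E'') (u₀, 0) := by
    have h1 : HasFDerivAt h (fderiv ℝ h u₀) ((u₀, (0 : F)).1) :=
      ((hh.contDiffAt (hU.mem_nhds hu₀)).differentiableAt hn).hasFDerivAt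
    have h2 := (h1.comp (u₀, (0 : F)) hasFDerivAt_fst).add
      (ι.hasFDerivAt.comp (u₀, (0 : F)) hasFDerivAt_snd)
    have h3 : (e : E × F →L[ℝ] E'') = (fderiv ℝ h u₀).comp (.fst ℝ E F) + ι.comp (.snd ℝ E F) :=
      ContinuousLinearMap.ext he
    rw [h3]
    exact h2
  have hc : ContDiffAt ℝ n Φ (u₀, 0) := hΦ.contDiffAt (hUo.mem_nhds hp₀)
  -- Smoothness of the inverse is needed on a whole neighbourhood, so the local inverse is
  -- restricted to the open set where the derivative of `Φ` remains invertible.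
  let S : Set (E × F) := (U ×ˢ univ) ∩ fderiv ℝ Φ ⁻¹' range ((↑) : ((E × F) ≃L[ℝ] E'') → _)
  have hS : IsOpen S :=
    (hΦ.continuousOn_fderiv_of_isOpen hUo
      (ENat.one_le_iff_ne_zero_withTop.2 hn)).isOpen_inter_preimage hUo ContinuousLinearEquiv.isOpen
  have hpS : ((u₀, 0) : E × F) ∈ S := ⟨hp₀, e, hd.fderiv.symm⟩
  let P := (hc.toOpenPartialHomeomorph Φ hd hn).restr S
  have hPs : P.source = (hc.toOpenPartialHomeomorph Φ hd hn).source ∩ S := by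
    simp [P, hS.interior_eq]
  have hP : ∀ p, P p = Φ p := fun p => rfl
  have hp₀P : ((u₀, 0) : E × F) ∈ P.source := by
    rw [hPs]; exact ⟨hc.mem_toOpenPartialHomeomorph_source hd hn, hpS⟩
  refine ⟨P.symm.trans e.toHomeomorph.toOpenPartialHomeomorph, e,
    (fun u => ((u, 0) : E × F)) ⁻¹' P.source, P.open_source.preimage (by fun_prop), hp₀P,
    fun u hu => ?_, ?_, ?_, fun u hu => ?_⟩
  · have : ((u, 0) : E × F) ∈ S := (hPs ▸ hu : _ ∈ _ ∩ S).2
    exact this.1.1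
  · have h3 : ContDiffOn ℝ n P.symm P.target := fun y hy => by
      have hy' : P.symm y ∈ S := (hPs ▸ P.map_target hy : _ ∈ _ ∩ S).2
      obtain ⟨e', he'⟩ := hy'.2
      have h4 : ContDiffAt ℝ n Φ (P.symm y) := hΦ.contDiffAt (hUo.mem_nhds hy'.1)
      refine (P.contDiffAt_symm (f₀' := e') hy ?_ h4).contDiffWithinAt
      rw [he']
      exact (h4.differentiableAt hn).hasFDerivAt
    simpa using e.contDiff.comp_contDiffOn h3
  · have h5 : ContDiffOn ℝ n P P.source :=
      hΦ.mono fun p hp => (hPs ▸ hp : _ ∈ _ ∩ S).2.1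
    refine h5.comp e.symm.contDiff.contDiffOn fun y hy => ?_
    simpa using hy
  · have h6 : P (u, 0) = h u := by simp [hP, Φ]
    have h7 := P.map_source hu
    have h8 := P.left_inv hu
    rw [h6] at h7 h8
    refine ⟨by simpa using h7, ?_⟩
    simp [h8]

/-- A smooth map between finite-dimensional manifolds without boundary whose differential at `x`
is injective is an immersion at `x`. -/
theorem isImmersionAtOfComplement_of_injective_mfderiv [FiniteDimensional ℝ E]
    [FiniteDimensional ℝ E''] [FiniteDimensional ℝ F] [I.Boundaryless] [J.Boundaryless]
    [IsManifold I n M] [IsManifold J n N] (hn : n ≠ 0) (hf : ContMDiff I J n f)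
    (hinj : Injective (mfderiv I J f x))
    (hF : Module.finrank ℝ E + Module.finrank ℝ F = Module.finrank ℝ E'') :
    IsImmersionAtOfComplement F I J n f x := by
  have hmd : MDifferentiableAt I J f x := hf.contMDiffAt.mdifferentiableAt hn
  let U := (extChartAt I x).target ∩ (extChartAt I x).symm ⁻¹' (f ⁻¹' (extChartAt J (f x)).source)
  have hU : IsOpen U := (continuousOn_extChartAt_symm x).isOpen_inter_preimage
    (isOpen_extChartAt_target x) ((isOpen_extChartAt_source (f x)).preimage hf.continuous)
  have hx₀ : extChartAt I x x ∈ U :=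
    ⟨mem_extChartAt_target x, by simp⟩
  have hw : ContDiffOn ℝ n (writtenInExtChartAt I J x f) U := (contMDiff_iff.1 hf).2 x (f x)
  rw [hmd.mfderiv, I.range_eq_univ, fderivWithin_univ] at hinj
  obtain ⟨Θ, e, U', hU', hx', hU'U, hΘ, hΘ', hst⟩ := exists_straightening hU hx₀ hn hw hinj hF
  -- Without boundary, `J` is a homeomorphism onto the vector space, so the straightening can be
  -- carried back to the model space and composed with the chart at `f x`.
  let Jh : G ≃ₜ E'' :=
    { toFun := J, invFun := J.symm, left_inv := J.left_inv
      right_inv := fun y => J.right_inv (by simp [J.range_eq_univ])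
      continuous_toFun := J.continuous, continuous_invFun := J.continuous_symm }
  let κ : OpenPartialHomeomorph N G := ((chartAt G (f x)).trans Jh.toOpenPartialHomeomorph).trans
    (Θ.trans Jh.symm.toOpenPartialHomeomorph)
  have hκ : ∀ y, κ.extend J y = Θ (extChartAt J (f x) y) := fun y => by
    change J (J.symm _) = _
    rw [J.right_inv (by simp [J.range_eq_univ])]; rfl
  have hκs : κ.source = (extChartAt J (f x)).source ∩ extChartAt J (f x) ⁻¹' Θ.source := by
    ext y
    simp [κ, extChartAt, Jh]
  have hκt : ∀ y ∈ κ.target, J y ∈ Θ.target ∧ Θ.symm (J y) ∈ (extChartAt J (f x)).target := by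
    intro y hy
    have : J y ∈ Θ.target ∧ J.symm (Θ.symm (J y)) ∈ (chartAt G (f x)).target := by
      simpa [κ, Jh] using hy
    exact ⟨this.1, by simpa [extChartAt, J.range_eq_univ] using this.2⟩
  have hJs : ContMDiff 𝓘(ℝ, E'') J n J.symm := by
    rw [← contMDiffOn_univ, ← J.range_eq_univ]; exact J.contMDiffOn_symm
  have hκm : κ ∈ IsManifold.maximalAtlas J n N := by
    refine κ.mem_maximalAtlas_of_contMDiffOn ?_ ?_
    · change ContMDiffOn J J n (J.symm ∘ Θ ∘ extChartAt J (f x)) κ.source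
      refine hJs.comp_contMDiffOn (hΘ.contMDiffOn.comp
        ((contMDiffOn_extChartAt (x := f x)).mono fun y hy => ?_) fun y hy => ?_)
      · rw [hκs] at hy; simpa using hy.1
      · rw [hκs] at hy; exact hy.2
    · change ContMDiffOn J J n ((extChartAt J (f x)).symm ∘ Θ.symm ∘ J) κ.target
      exact (contMDiffOn_extChartAt_symm (f x)).comp
        (hΘ'.contMDiffOn.comp J.contMDiff.contMDiffOn fun y hy => (hκt y hy).1)
        fun y hy => (hκt y hy).2
  have hD : IsOpen ((chartAt H x).source ∩ extChartAt I x ⁻¹' U') := by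
    have := (continuousOn_extChartAt (I := I) x).isOpen_inter_preimage
      (isOpen_extChartAt_source x) hU'
    simpa using this
  refine IsImmersionAtOfComplement.mk_of_continuousAt hf.continuous.continuousAt e
    ((chartAt H x).restr ((chartAt H x).source ∩ extChartAt I x ⁻¹' U')) κ ?_ ?_ ?_ hκm ?_
  · rw [(chartAt H x).restr_source, hD.interior_eq]
    exact ⟨mem_chart_source H x, mem_chart_source H x, hx'⟩
  · rw [hκs]
    refine ⟨mem_extChartAt_source (f x), ?_⟩
    have := (hst _ hx').1
    simpa [writtenInExtChartAt, extChartAt_to_inv] using this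
  · exact restr_mem_maximalAtlas _ (IsManifold.chart_mem_maximalAtlas x) hD
  · intro u hu
    have hu2 : u ∈ (extChartAt I x).target ∧ u ∈ U' := by
      have h9 : u ∈ (((chartAt H x).restr
        ((chartAt H x).source ∩ extChartAt I x ⁻¹' U')).extend I).target := hu
      simp only [OpenPartialHomeomorph.extend_target, OpenPartialHomeomorph.restr_target,
        hD.interior_eq, I.range_eq_univ, inter_univ, mem_preimage, mem_inter_iff] at h9
      have h10 : u ∈ (extChartAt I x).target := by
        simpa [extChartAt, I.range_eq_univ] using h9.1
      have h11 : extChartAt I x ((extChartAt I x).symm u) ∈ U' := h9.2.2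
      rw [(extChartAt I x).right_inv h10] at h11
      exact ⟨h10, h11⟩
    have := (hst u hu2.2).2
    simp only [comp_apply, hκ]
    exact this

end Immersion

end Manifold

/-! ### Symmetric functions of the eigenvalues in rank two -/

/-- A square matrix of size `4` whose last two columns vanish has zero third and fourth elementary
symmetric functions of the eigenvalues. -/
theorem Matrix.esymm_roots_charpoly_eq_zero {A : Matrix (Fin 4) (Fin 4) ℝ}
    (h : ∀ i (j : Fin 2), A i (Fin.natAdd 2 j) = 0) {r : ℕ} (hr : 3 ≤ r) :
    A.charpoly.roots.esymm r = 0 := by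
  -- Factoring `A = B * C` through dimension two gives the characteristic polynomial `X²` times that
  -- of the matrix `C * B` of size two.
  let B : Matrix (Fin 4) (Fin 2) ℝ := .of fun i j => A i (Fin.castAdd 2 j)
  let C : Matrix (Fin 2) (Fin 4) ℝ := .of fun i j => if j = Fin.castAdd 2 i then 1 else 0
  have hA : A = B * C := by
    ext i j
    rw [Matrix.mul_apply, Fin.sum_univ_two]
    refine Fin.addCases (m := 2) (n := 2) (fun j => ?_) (fun j => ?_) j
    · fin_cases j <;> simp [B, C]
    · rw [h]; fin_cases j <;> simp [B, C, Fin.ext_iff]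
  have hc : A.charpoly = Polynomial.X ^ 2 * (C * B).charpoly := by
    rw [hA, Matrix.charpoly_mul_comm_of_le B C (by simp)]; simp
  have hne : (Polynomial.X ^ 2 * (C * B).charpoly) ≠ 0 :=
    mul_ne_zero (pow_ne_zero _ Polynomial.X_ne_zero) (Matrix.charpoly_monic _).ne_zero
  have hcard : Multiset.card (C * B).charpoly.roots ≤ 2 := by
    refine (Polynomial.card_roots' _).trans ?_
    rw [Matrix.charpoly_natDegree_eq_dim]; simp
  rw [hc, Polynomial.roots_mul hne, Polynomial.roots_X_pow, Multiset.esymm]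
  refine Multiset.sum_eq_zero fun x hx => ?_
  obtain ⟨t, ht, rfl⟩ := Multiset.mem_map.1 hx
  obtain ⟨htle, htc⟩ := Multiset.mem_powersetCard.1 ht
  -- A selection of roots that avoids `0` consists of roots of `C * B`, so it has at most two
  -- members, fewer than `r`.
  refine Multiset.prod_eq_zero (by_contra fun h0 => ?_)
  have h1 : t ≤ (C * B).charpoly.roots := by
    rw [Multiset.le_iff_count]
    intro a
    by_cases ha : a = 0
    · subst ha; simp [Multiset.count_eq_zero_of_notMem h0]
    · have := Multiset.le_iff_count.1 htle a
      simpa [Multiset.count_singleton, ha] using this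
  have := Multiset.card_le_card h1
  omega

/-! ### Base and fibre coordinates on `ℝ⁴` -/

namespace SphereImmersion

/-- The splitting `ℝ⁴ = ℝ² × ℝ²`. -/
noncomputable def splitCoord : EuclideanSpace ℝ (Fin 4) ≃L[ℝ]
    EuclideanSpace ℝ (Fin 2) × EuclideanSpace ℝ (Fin 2) :=
  EuclideanSpace.finAddEquivProd (n := 2) (m := 2)

theorem splitCoord_single_castAdd (i : Fin 2) :
    splitCoord (EuclideanSpace.single (Fin.castAdd 2 i) 1) = (EuclideanSpace.single i 1, 0) := by
  refine splitCoord.symm.injective ?_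
  rw [ContinuousLinearEquiv.symm_apply_apply]
  ext k
  refine Fin.addCases (m := 2) (n := 2) (fun j => ?_) (fun j => ?_) k <;>
  fin_cases i <;> fin_cases j <;> simp [splitCoord] <;> rfl

theorem splitCoord_single_natAdd (i : Fin 2) :
    splitCoord (EuclideanSpace.single (Fin.natAdd 2 i) 1) = (0, EuclideanSpace.single i 1) := by
  refine splitCoord.symm.injective ?_
  rw [ContinuousLinearEquiv.symm_apply_apply]
  ext k
  refine Fin.addCases (m := 2) (n := 2) (fun j => ?_) (fun j => ?_) k <;>
  fin_cases i <;> fin_cases j <;> simp [splitCoord] <;> rfl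

/-- The first two coordinates on `ℝ⁴`. -/
noncomputable def baseCoord : EuclideanSpace ℝ (Fin 4) →L[ℝ] EuclideanSpace ℝ (Fin 2) :=
  (ContinuousLinearMap.fst ℝ _ _).comp
    (splitCoord : _ →L[ℝ] EuclideanSpace ℝ (Fin 2) × EuclideanSpace ℝ (Fin 2))

/-- The last two coordinates on `ℝ⁴`. -/
noncomputable def fibreCoord : EuclideanSpace ℝ (Fin 4) →L[ℝ] EuclideanSpace ℝ (Fin 2) :=
  (ContinuousLinearMap.snd ℝ _ _).comp
    (splitCoord : _ →L[ℝ] EuclideanSpace ℝ (Fin 2) × EuclideanSpace ℝ (Fin 2))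

theorem splitCoord_apply (z : EuclideanSpace ℝ (Fin 4)) :
    splitCoord z = (baseCoord z, fibreCoord z) := rfl

@[simp]
theorem baseCoord_splitCoord_symm (p : EuclideanSpace ℝ (Fin 2) × EuclideanSpace ℝ (Fin 2)) :
    baseCoord (splitCoord.symm p) = p.1 :=
  congrArg Prod.fst (splitCoord.apply_symm_apply p)

theorem baseCoord_single_castAdd (i : Fin 2) :
    baseCoord (EuclideanSpace.single (Fin.castAdd 2 i) 1) = EuclideanSpace.single i 1 :=
  congrArg Prod.fst (splitCoord_single_castAdd i)

theorem baseCoord_single_natAdd (i : Fin 2) :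
    baseCoord (EuclideanSpace.single (Fin.natAdd 2 i) 1) = 0 :=
  congrArg Prod.fst (splitCoord_single_natAdd i)

/-! ### Trace-free forms on a plane and the trace of the polar form -/

section LinearAlgebra

variable {W : Type*} [NormedAddCommGroup W] [InnerProductSpace ℝ W]

/-- The Gram matrix of the images of the coordinate vectors. -/
noncomputable def gramMatrix {n : ℕ} (D : EuclideanSpace ℝ (Fin n) →L[ℝ] W) : Matrix (Fin n) (Fin n) ℝ :=
  Matrix.of fun i j => ⟪D (EuclideanSpace.single i 1), D (EuclideanSpace.single j 1)⟫_ℝ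

theorem posDef_gramMatrix {n : ℕ} {D : EuclideanSpace ℝ (Fin n) →L[ℝ] W} (hD : Injective D) :
    (gramMatrix D).PosDef := by
  refine Matrix.posDef_gram_of_linearIndependent (𝕜 := ℝ)
    (v := fun i => D (EuclideanSpace.single i 1)) ?_
  have := (EuclideanSpace.basisFun (Fin n) ℝ).toBasis.linearIndependent.map'
    (D : EuclideanSpace ℝ (Fin n) →ₗ[ℝ] W) (LinearMap.ker_eq_bot.2 hD)
  convert! this using 1
  ext i
  simp

theorem sum_inv_two (A : Matrix (Fin 2) (Fin 2) ℝ) (b : Fin 2 → Fin 2 → ℝ)  :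
    ∑ i, ∑ j, A⁻¹ i j * b i j =
      A.det⁻¹ * (A 1 1 * b 0 0 - A 0 1 * b 0 1 - A 1 0 * b 1 0 + A 0 0 * b 1 1) := by
  rw [Matrix.inv_def, Matrix.adjugate_fin_two]
  simp [Fin.sum_univ_two]
  ring

/-- A nonzero symmetric bilinear form on a Euclidean plane with zero trace is nondegenerate. -/
theorem det_ne_zero_of_trace_eq_zero {A : Matrix (Fin 2) (Fin 2) ℝ} (hA : A.PosDef)
    {b : Fin 2 → Fin 2 → ℝ} (hb : b 1 0 = b 0 1) (htr : ∑ i, ∑ j, A⁻¹ i j * b i j = 0)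
    (hne : ∃ i j, b i j ≠ 0) : b 0 0 * b 1 1 - b 0 1 * b 0 1 ≠ 0 := by
  have hdet := hA.det_pos
  have h00 : 0 < A 0 0 := hA.diag_pos
  have hs : A 1 0 = A 0 1 := by simpa using hA.isHermitian.apply 0 1
  rw [sum_inv_two, mul_eq_zero, or_iff_right (inv_pos.2 hdet).ne', hb, hs] at htr
  rw [Matrix.det_fin_two, hs] at hdet
  intro h
  -- Eliminating `b 1 1` between the zero trace and the zero determinant and completing the square
  -- leaves a sum of nonnegative terms, by positivity of `A`.
  have key : (A 0 0 * b 0 1 - A 0 1 * b 0 0) ^ 2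
      + (A 0 0 * A 1 1 - A 0 1 * A 0 1) * b 0 0 ^ 2 = 0 := by
    linear_combination (A 0 0 * b 0 0) * htr - (A 0 0) ^ 2 * h
  have h1 : b 0 0 = 0 := by
    by_contra h0
    have : 0 < (A 0 0 * A 1 1 - A 0 1 * A 0 1) * b 0 0 ^ 2 := by positivity
    nlinarith [sq_nonneg (A 0 0 * b 0 1 - A 0 1 * b 0 0)]
  have h2 : b 0 1 = 0 := by
    rw [h1] at h; simpa using h
  have h3 : b 1 1 = 0 := by
    rw [h1, h2] at htr
    simpa [h00.ne'] using htr
  obtain ⟨i, j, hij⟩ := hne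
  fin_cases i <;> fin_cases j <;> simp_all

/-- If `⟪DV X, DG a⟫ = -H (X, a)` for a nondegenerate form `H` that is trace-free with respect to
`DG`, and the range of `DV` contains that of `DG`, then `H` is trace-free with respect to `DV`. -/
theorem trace_polar_eq_zero {DG : EuclideanSpace ℝ (Fin 2) →L[ℝ] W}
    {DV : EuclideanSpace ℝ (Fin 4) →L[ℝ] W}
    {H : EuclideanSpace ℝ (Fin 2) →L[ℝ] EuclideanSpace ℝ (Fin 2) →L[ℝ] ℝ}
    (hH : ∀ a b, H a b = H b a) (hpair : ∀ X a, ⟪DV X, DG a⟫_ℝ = -H (baseCoord X) a)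
    (hrange : ∀ a, ∃ X, DV X = DG a) (hDG : Injective DG) (hDV : Injective DV)
    (htr : ∑ i, ∑ j, (gramMatrix DG)⁻¹ i j *
      H (EuclideanSpace.single i 1) (EuclideanSpace.single j 1) = 0)
    (hdet : H (EuclideanSpace.single 0 1) (EuclideanSpace.single 0 1) *
      H (EuclideanSpace.single 1 1) (EuclideanSpace.single 1 1) -
      H (EuclideanSpace.single 0 1) (EuclideanSpace.single 1 1) *
      H (EuclideanSpace.single 0 1) (EuclideanSpace.single 1 1) ≠ 0) :
    ∑ i, ∑ j, (gramMatrix DV)⁻¹ i j *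
      H (baseCoord (EuclideanSpace.single i 1)) (baseCoord (EuclideanSpace.single j 1))
        = 0 := by
  choose P hP using hrange
  -- The sign cancels the one in `hpair`, so that `⟪DV X, DV (A j)⟫ = H (baseCoord X) e_j`. The
  -- coordinates of `A j` are then a column of `(gramMatrix DV)⁻¹ * K`, and the trace can be read
  -- off without inverting a matrix of size four.
  let A : Fin 2 → EuclideanSpace ℝ (Fin 4) := fun j => -P (EuclideanSpace.single j 1)
  have hA : ∀ j, DV (A j) = -DG (EuclideanSpace.single j 1) := fun j => by simp [A, hP]
  let K : Matrix (Fin 4) (Fin 2) ℝ :=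
    .of fun k j => H (baseCoord (EuclideanSpace.single k 1)) (EuclideanSpace.single j 1)
  let Am : Matrix (Fin 4) (Fin 2) ℝ := .of fun k j => A j k
  have hsum : ∀ X : EuclideanSpace ℝ (Fin 4), X = ∑ k, X k • EuclideanSpace.single k (1 : ℝ) :=
    fun X => by
      have := ((EuclideanSpace.basisFun (Fin 4) ℝ).sum_repr X).symm
      simpa using this
  have hK : gramMatrix DV * Am = K := by
    ext k j
    have h1 : ⟪DV (EuclideanSpace.single k 1), DV (A j)⟫_ℝ = K k j := by
      rw [hA, inner_neg_right, hpair, neg_neg]; rfl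
    rw [← h1, hsum (A j), map_sum, inner_sum, Matrix.mul_apply]
    refine Finset.sum_congr rfl fun l _ => ?_
    rw [map_smul, real_inner_smul_right, mul_comm]
    rfl
  have hAm : (gramMatrix DV)⁻¹ * K = Am := by
    rw [← hK, ← Matrix.mul_assoc, Matrix.nonsing_inv_mul _
      ((posDef_gramMatrix hDV).det_pos.ne'.isUnit), Matrix.one_mul]
  have hfst : ∀ X : EuclideanSpace ℝ (Fin 4), baseCoord X =
      X 0 • EuclideanSpace.single 0 1 + X 1 • EuclideanSpace.single 1 1 := fun X => by
    ext i; fin_cases i <;> simp [baseCoord, splitCoord] <;> rfl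
  have hlhs : ∑ i, ∑ j, (gramMatrix DV)⁻¹ i j *
      H (baseCoord (EuclideanSpace.single i 1)) (baseCoord (EuclideanSpace.single j 1))
        = A 0 0 + A 1 1 := by
    have h2 : ∀ i : Fin 2, A i (Fin.castAdd 2 i) = ∑ j, (gramMatrix DV)⁻¹ (Fin.castAdd 2 i) j *
        H (EuclideanSpace.single i 1) (baseCoord (EuclideanSpace.single j 1)) := fun i => by
      have h3 : A i (Fin.castAdd 2 i) = ((gramMatrix DV)⁻¹ * K) (Fin.castAdd 2 i) i := by
        rw [hAm]; rfl
      rw [h3, Matrix.mul_apply]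
      exact Finset.sum_congr rfl fun j _ => by rw [hH]; rfl
    have h4 : A 0 0 + A 1 1 = ∑ i : Fin 2, A i (Fin.castAdd 2 i) := by
      rw [Fin.sum_univ_two]; rfl
    rw [h4, Fin.sum_univ_add (a := 2) (b := 2)]
    simp only [baseCoord_single_castAdd, baseCoord_single_natAdd, h2]
    simp
  rw [hlhs]
  -- The base components of the `A i` form the matrix `g H⁻¹`, where `g = gramMatrix DG`; the trace
  -- sought is the trace of this matrix.
  have hrel : ∀ i j : Fin 2, H (baseCoord (A i)) (EuclideanSpace.single j 1) =
      gramMatrix DG i j := fun i j => by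
    have := hpair (A i) (EuclideanSpace.single j 1)
    rw [hA, inner_neg_left] at this
    exact (neg_inj.1 this).symm
  simp only [hfst, map_add, map_smul, add_apply,
    smul_apply, smul_eq_mul] at hrel
  have hdetG := (posDef_gramMatrix hDG).det_pos
  have r00 := hrel 0 0
  have r01 := hrel 0 1
  have r10 := hrel 1 0
  have r11 := hrel 1 1
  rw [sum_inv_two, mul_eq_zero, or_iff_right (inv_pos.2 hdetG).ne'] at htr
  have hs := hH (EuclideanSpace.single 1 1) (EuclideanSpace.single 0 1)
  have hs' : gramMatrix DG 1 0 = gramMatrix DG 0 1 := real_inner_comm _ _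
  rw [hs, hs'] at htr
  rw [hs] at r00 r10
  rw [hs'] at r10
  -- This is the identity `det H · tr(g H⁻¹) = det g · tr(g⁻¹ H)` for symmetric matrices of size
  -- two, with the inverses cleared.
  refine (mul_eq_zero.1 ?_).resolve_left hdet
  linear_combination htr + H (EuclideanSpace.single 1 1) (EuclideanSpace.single 1 1) * r00
    - H (EuclideanSpace.single 0 1) (EuclideanSpace.single 1 1) * r01
    - H (EuclideanSpace.single 0 1) (EuclideanSpace.single 1 1) * r10
    + H (EuclideanSpace.single 0 1) (EuclideanSpace.single 0 1) * r11

end LinearAlgebra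

end SphereImmersion

/-! ### Local calculus of a surface and its unit normal field -/

namespace SphereImmersion

section Calculus

variable {E W : Type*} [NormedAddCommGroup E] [NormedSpace ℝ E]
  [NormedAddCommGroup W] [InnerProductSpace ℝ W]

theorem inner_fderiv_add_eq_zero {f h : E → W} {f' h' : E →L[ℝ] W} {z : E}
    (hf : HasFDerivAt f f' z) (hh : HasFDerivAt h h' z) {c : ℝ}
    (hc : ∀ᶠ w in 𝓝 z, ⟪f w, h w⟫_ℝ = c) (X : E) : ⟪f z, h' X⟫_ℝ + ⟪f' X, h z⟫_ℝ = 0 := by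
  have h1 := hf.inner ℝ hh
  have h2 : HasFDerivAt (fun w => ⟪f w, h w⟫_ℝ) (0 : E →L[ℝ] ℝ) z :=
    (hasFDerivAt_const c z).congr_of_eventuallyEq hc
  simpa using congr($(h1.unique h2) X)

variable {G : EuclideanSpace ℝ (Fin 2) → W} {V : EuclideanSpace ℝ (Fin 4) → W}
  {z : EuclideanSpace ℝ (Fin 4)}

/-- Local data of the polar map: `G` parametrizes a surface in the unit sphere and `V` is a
unit normal field along it, depending on two more parameters. -/
structure IsPolarPair (G : EuclideanSpace ℝ (Fin 2) → W) (V : EuclideanSpace ℝ (Fin 4) → W)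
    (z : EuclideanSpace ℝ (Fin 4)) : Prop where
  contDiffAt_base : ∀ᶠ u in 𝓝 (baseCoord z), ContDiffAt ℝ ∞ G u
  contDiffAt_normal : ∀ᶠ w in 𝓝 z, ContDiffAt ℝ ∞ V w
  norm_base : ∀ᶠ u in 𝓝 (baseCoord z), ⟪G u, G u⟫_ℝ = 1
  norm_normal : ∀ᶠ w in 𝓝 z, ⟪V w, V w⟫_ℝ = 1
  inner_normal_base : ∀ᶠ w in 𝓝 z, ⟪V w, G (baseCoord w)⟫_ℝ = 0
  inner_normal_fderiv : ∀ᶠ w in 𝓝 z, ∀ a, ⟪V w, fderiv ℝ G (baseCoord w) a⟫_ℝ = 0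
  exists_retraction : ∃ R : W → EuclideanSpace ℝ (Fin 2), DifferentiableAt ℝ R (V z) ∧
    ∀ᶠ w in 𝓝 z, R (V w) = fibreCoord w

namespace IsPolarPair

theorem hasFDerivAt_base (h : IsPolarPair G V z) :
    HasFDerivAt G (fderiv ℝ G (baseCoord z)) (baseCoord z) :=
  (h.contDiffAt_base.self_of_nhds.differentiableAt (by simp)).hasFDerivAt

theorem hasFDerivAt_base_comp (h : IsPolarPair G V z) :
    HasFDerivAt (fun w => G (baseCoord w)) ((fderiv ℝ G (baseCoord z)).comp baseCoord) z :=
  h.hasFDerivAt_base.comp z baseCoord.hasFDerivAt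

theorem hasFDerivAt_normal (h : IsPolarPair G V z) : HasFDerivAt V (fderiv ℝ V z) z :=
  (h.contDiffAt_normal.self_of_nhds.differentiableAt (by simp)).hasFDerivAt

theorem hasFDerivAt_fderiv_base (h : IsPolarPair G V z) : HasFDerivAt (fderiv ℝ G)
    (fderiv ℝ (fderiv ℝ G) (baseCoord z)) (baseCoord z) :=
  ((h.contDiffAt_base.self_of_nhds.fderiv_right (m := 1) (by norm_cast)).differentiableAt
    (by simp)).hasFDerivAt

theorem hasFDerivAt_fderiv_normal (h : IsPolarPair G V z) :
    HasFDerivAt (fderiv ℝ V) (fderiv ℝ (fderiv ℝ V) z) z :=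
  ((h.contDiffAt_normal.self_of_nhds.fderiv_right (m := 1) (by norm_cast)).differentiableAt
    (by simp)).hasFDerivAt

theorem inner_self_normal (h : IsPolarPair G V z) : ⟪V z, V z⟫_ℝ = 1 := h.norm_normal.self_of_nhds

theorem inner_self_base (h : IsPolarPair G V z) :
    ⟪G (baseCoord z), G (baseCoord z)⟫_ℝ = 1 := h.norm_base.self_of_nhds

theorem inner_fderiv_normal_normal (h : IsPolarPair G V z) (X) : ⟪fderiv ℝ V z X, V z⟫_ℝ = 0 := by
  have := inner_fderiv_add_eq_zero h.hasFDerivAt_normal h.hasFDerivAt_normal h.norm_normal X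
  rw [real_inner_comm] at this
  linarith

theorem inner_fderiv_base_base (h : IsPolarPair G V z) (a) :
    ⟪fderiv ℝ G (baseCoord z) a, G (baseCoord z)⟫_ℝ = 0 := by
  have := inner_fderiv_add_eq_zero h.hasFDerivAt_base h.hasFDerivAt_base h.norm_base a
  rw [real_inner_comm] at this
  linarith

/-- Differentiating `⟪V, G⟫ = 0` leaves only this term, since `V` is orthogonal to `dG`. It is
recorded on a neighbourhood so that it can be differentiated once more. -/
theorem eventually_inner_fderiv_normal_base (h : IsPolarPair G V z) :
    ∀ᶠ w in 𝓝 z, ∀ X, ⟪fderiv ℝ V w X, G (baseCoord w)⟫_ℝ = 0 := by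
  filter_upwards [h.contDiffAt_normal, baseCoord.continuous.continuousAt.eventually
    h.contDiffAt_base, h.inner_normal_base.eventually_nhds, h.inner_normal_fderiv]
    with w hV hG hVG hVd X
  have := inner_fderiv_add_eq_zero (hV.differentiableAt (by simp)).hasFDerivAt
    ((hG.differentiableAt (by simp)).hasFDerivAt.comp w baseCoord.hasFDerivAt) hVG X
  simpa [hVd] using this

theorem inner_fderiv_normal_base (h : IsPolarPair G V z) (X) :
    ⟪fderiv ℝ V z X, G (baseCoord z)⟫_ℝ = 0 :=
  h.eventually_inner_fderiv_normal_base.self_of_nhds X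

/-- The derivative of `⟪V, dG a⟫ = 0`. Only the base part of `X` enters because `G` does not depend
on the fibre coordinates. -/
theorem inner_fderiv_normal_fderiv_base (h : IsPolarPair G V z) (X a) :
    ⟪fderiv ℝ V z X, fderiv ℝ G (baseCoord z) a⟫_ℝ =
      -⟪V z, fderiv ℝ (fderiv ℝ G) (baseCoord z) (baseCoord X) a⟫_ℝ := by
  have h1 : HasFDerivAt (fun w => fderiv ℝ G (baseCoord w) a) _ z :=
    (h.hasFDerivAt_fderiv_base.comp z (baseCoord.hasFDerivAt)).clm_apply
      (hasFDerivAt_const a z)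
  have := inner_fderiv_add_eq_zero h.hasFDerivAt_normal h1
    (h.inner_normal_fderiv.mono fun w hw => hw a) X
  simp at this
  linarith

/-- The derivative of `⟪dV Y, G⟫ = 0`, combined with the preceding relation. It exhibits the second
fundamental form of `V` towards `G` as the pullback of that of `G` towards `V`. -/
theorem inner_fderiv_fderiv_normal_base (h : IsPolarPair G V z) (X Y) :
    ⟪fderiv ℝ (fderiv ℝ V) z X Y, G (baseCoord z)⟫_ℝ =
      ⟪V z, fderiv ℝ (fderiv ℝ G) (baseCoord z) (baseCoord Y) (baseCoord X)⟫_ℝ := by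
  have h1 : HasFDerivAt (fun w => fderiv ℝ V w Y) _ z :=
    h.hasFDerivAt_fderiv_normal.clm_apply (hasFDerivAt_const Y z)
  have := inner_fderiv_add_eq_zero h1 h.hasFDerivAt_base_comp
    (h.eventually_inner_fderiv_normal_base.mono fun w hw => hw Y) X
  have h2 := h.inner_fderiv_normal_fderiv_base Y (baseCoord X)
  simp only [ContinuousLinearMap.comp_apply, h2] at this
  simp at this
  linarith

/-- The second fundamental form of `G` in the direction of the normal `V`. -/
noncomputable def form (_ : IsPolarPair G V z) :
    EuclideanSpace ℝ (Fin 2) →L[ℝ] EuclideanSpace ℝ (Fin 2) →L[ℝ] ℝ :=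
  (ContinuousLinearMap.compL ℝ _ W ℝ (innerSL ℝ (V z))).comp
    (fderiv ℝ (fderiv ℝ G) (baseCoord z))

theorem form_apply (h : IsPolarPair G V z) (a b) :
    h.form a b = ⟪V z, fderiv ℝ (fderiv ℝ G) (baseCoord z) a b⟫_ℝ := rfl

theorem form_symm (h : IsPolarPair G V z) (a b) : h.form a b = h.form b a := by
  rw [form_apply, form_apply]
  have := h.contDiffAt_base.self_of_nhds.isSymmSndFDerivAt (by simp; norm_cast)
  rw [this.eq]

/-- The determinant of the form in the coordinate basis does not vanish if the form is nonzero and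
trace-free. -/
theorem form_det_ne_zero (h : IsPolarPair G V z) (hG : Injective (fderiv ℝ G (baseCoord z)))
    (htr : ∑ i, ∑ j, (gramMatrix (fderiv ℝ G (baseCoord z)))⁻¹ i j *
      h.form (EuclideanSpace.single i 1) (EuclideanSpace.single j 1) = 0)
    (hne : ∃ a b, h.form a b ≠ 0) :
    h.form (EuclideanSpace.single 0 1) (EuclideanSpace.single 0 1) *
      h.form (EuclideanSpace.single 1 1) (EuclideanSpace.single 1 1) -
      h.form (EuclideanSpace.single 0 1) (EuclideanSpace.single 1 1) *
      h.form (EuclideanSpace.single 0 1) (EuclideanSpace.single 1 1) ≠ 0 := by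
  refine det_ne_zero_of_trace_eq_zero (posDef_gramMatrix hG) (h.form_symm _ _) htr ?_
  by_contra! h0
  obtain ⟨a, b, hab⟩ := hne
  refine hab ?_
  have hB : h.form = 0 := by
    refine ContinuousLinearMap.coe_injective
      ((EuclideanSpace.basisFun (Fin 2) ℝ).toBasis.ext fun i => ?_)
    refine ContinuousLinearMap.coe_injective
      ((EuclideanSpace.basisFun (Fin 2) ℝ).toBasis.ext fun j => ?_)
    simpa using h0 i j
  rw [hB]; rfl

theorem fderiv_normal_injective (h : IsPolarPair G V z)
    (hdet : h.form (EuclideanSpace.single 0 1) (EuclideanSpace.single 0 1) *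
      h.form (EuclideanSpace.single 1 1) (EuclideanSpace.single 1 1) -
      h.form (EuclideanSpace.single 0 1) (EuclideanSpace.single 1 1) *
      h.form (EuclideanSpace.single 0 1) (EuclideanSpace.single 1 1) ≠ 0) :
    Injective (fderiv ℝ V z) := by
  have hnd : ∀ a, (∀ b, h.form a b = 0) → a = 0 := fun a ha => by
    have ha' : a = a 0 • EuclideanSpace.single 0 1 + a 1 • EuclideanSpace.single 1 1 := by
      ext i; fin_cases i <;> simp
    have h0 := ha (EuclideanSpace.single 0 1)
    have h1 := ha (EuclideanSpace.single 1 1)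
    rw [ha'] at h0 h1
    simp only [map_add, map_smul, add_apply, smul_apply, smul_eq_mul] at h0 h1
    rw [h.form_symm (EuclideanSpace.single 1 1) (EuclideanSpace.single 0 1)] at h0
    have e0 : a 0 = 0 := (mul_eq_zero.1 (by
      linear_combination h.form (EuclideanSpace.single 1 1) (EuclideanSpace.single 1 1) * h0
        - h.form (EuclideanSpace.single 0 1) (EuclideanSpace.single 1 1) * h1)).resolve_right hdet
    have e1 : a 1 = 0 := (mul_eq_zero.1 (by
      linear_combination h.form (EuclideanSpace.single 0 1) (EuclideanSpace.single 0 1) * h1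
        - h.form (EuclideanSpace.single 0 1) (EuclideanSpace.single 1 1) * h0)).resolve_right hdet
    rw [ha', e0, e1]; simp
  refine (injective_iff_map_eq_zero _).2 fun X hX => ?_
  have h1 : baseCoord X = 0 := hnd _ fun b => by
    have := h.inner_fderiv_normal_fderiv_base X b
    rw [hX, inner_zero_left] at this
    rw [form_apply]; linarith
  obtain ⟨R, hR, hRV⟩ := h.exists_retraction
  -- The fibre coordinates factor through `V` via the retraction, so their differential kills the
  -- kernel of `dV`.
  have h2 : fibreCoord X = 0 := by
    have h3 := (hR.hasFDerivAt.comp z h.hasFDerivAt_normal).congr_of_eventuallyEq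
      (hRV.mono fun w hw => hw.symm)
    have := congr($(fibreCoord.hasFDerivAt.unique h3) X)
    simpa [hX] using this
  have : splitCoord X = 0 := by rw [splitCoord_apply, h1, h2]; rfl
  simpa using this

section Codimension

variable [FiniteDimensional ℝ W]

/-- The line of `V` and the range of `dV` are orthogonal and span dimension `1 + 4` in `ℝ⁶`, and `G`
is a unit vector orthogonal to both. -/
theorem orthogonal_eq_span (h : IsPolarPair G V z) (hW : Module.finrank ℝ W = 6)
    (hinj : Injective (fderiv ℝ V z)) :
    ((ℝ ∙ V z) ⊔ (fderiv ℝ V z).range)ᗮ = ℝ ∙ G (baseCoord z) := by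
  have hV0 : V z ≠ 0 := fun h0 => by simpa [h0] using h.inner_self_normal
  have hG0 : G (baseCoord z) ≠ 0 := fun h0 => by simpa [h0] using h.inner_self_base
  have hdisj : (ℝ ∙ V z) ⊓ (fderiv ℝ V z).range = ⊥ := by
    refine (Submodule.eq_bot_iff _).2 fun w hw => ?_
    obtain ⟨c, rfl⟩ := Submodule.mem_span_singleton.1 hw.1
    obtain ⟨X, hX⟩ := hw.2
    have := h.inner_fderiv_normal_normal X
    rw [show fderiv ℝ V z X = c • V z from hX, real_inner_smul_left, h.inner_self_normal] at this
    simp_all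
  have hsum := Submodule.finrank_sup_add_finrank_inf_eq (ℝ ∙ V z) (fderiv ℝ V z).range
  have hr : Module.finrank ℝ (fderiv ℝ V z).range = 4 :=
    (LinearMap.finrank_range_of_inj hinj).trans finrank_euclideanSpace_fin
  rw [hdisj, finrank_bot, finrank_span_singleton hV0, hr] at hsum
  have hadd := Submodule.finrank_add_finrank_orthogonal ((ℝ ∙ V z) ⊔ (fderiv ℝ V z).range)
  symm
  refine Submodule.eq_of_le_of_finrank_eq ?_ ?_
  · rw [Submodule.span_singleton_le_iff_mem, Submodule.mem_orthogonal]
    intro w hw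
    obtain ⟨a, ha, b, hb, rfl⟩ := Submodule.mem_sup.1 hw
    obtain ⟨c, rfl⟩ := Submodule.mem_span_singleton.1 ha
    obtain ⟨X, rfl⟩ := hb
    rw [inner_add_left, real_inner_smul_left, h.inner_normal_base.self_of_nhds]
    simpa using h.inner_fderiv_normal_base X
  · rw [finrank_span_singleton hG0]; omega

/-- Since `dG a` is orthogonal to `G`, it lies in the sum of the line of `V` and the range of `dV`;
pairing with `V` removes the first component. -/
theorem exists_fderiv_normal_eq (h : IsPolarPair G V z) (hW : Module.finrank ℝ W = 6)
    (hinj : Injective (fderiv ℝ V z)) (a) : ∃ X, fderiv ℝ V z X = fderiv ℝ G (baseCoord z) a := by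
  have h1 := congrArg Submodule.orthogonal (h.orthogonal_eq_span hW hinj)
  rw [Submodule.orthogonal_orthogonal] at h1
  have h2 : fderiv ℝ G (baseCoord z) a ∈ (ℝ ∙ V z) ⊔ (fderiv ℝ V z).range := by
    rw [h1, Submodule.mem_orthogonal_singleton_iff_inner_left]
    exact h.inner_fderiv_base_base a
  obtain ⟨v, hv, w, ⟨X, rfl⟩, hvw⟩ := Submodule.mem_sup.1 h2
  obtain ⟨c, rfl⟩ := Submodule.mem_span_singleton.1 hv
  have h3 := h.inner_normal_fderiv.self_of_nhds a
  have h4 : ⟪V z, fderiv ℝ V z X⟫_ℝ = 0 := by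
    rw [real_inner_comm]; exact h.inner_fderiv_normal_normal X
  rw [← hvw, inner_add_right, real_inner_smul_right, h.inner_self_normal] at h3
  have hc : c = 0 := by
    have : c * 1 + ⟪V z, fderiv ℝ V z X⟫_ℝ = 0 := h3
    linarith
  exact ⟨X, by simpa [hc] using hvw⟩

theorem trace_form_normal_eq_zero (h : IsPolarPair G V z) (hW : Module.finrank ℝ W = 6)
    (hG : Injective (fderiv ℝ G (baseCoord z)))
    (htr : ∑ i, ∑ j, (gramMatrix (fderiv ℝ G (baseCoord z)))⁻¹ i j *
      h.form (EuclideanSpace.single i 1) (EuclideanSpace.single j 1) = 0)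
    (hne : ∃ a b, h.form a b ≠ 0) :
    ∑ i, ∑ j, (gramMatrix (fderiv ℝ V z))⁻¹ i j *
      h.form (baseCoord (EuclideanSpace.single i 1)) (baseCoord (EuclideanSpace.single j 1)) = 0 :=
  have hdet := h.form_det_ne_zero hG htr hne
  have hinj := h.fderiv_normal_injective hdet
  trace_polar_eq_zero h.form_symm h.inner_fderiv_normal_fderiv_base
    (h.exists_fderiv_normal_eq hW hinj) hG hinj htr hdet

end Codimension

end IsPolarPair

end Calculus

end SphereImmersion

/-! ### The invariants in the preferred chart -/

namespace SphereImmersion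

section LocalRep

variable {n : ℕ} {M : Type*} [TopologicalSpace M] [ChartedSpace (EuclideanSpace ℝ (Fin n)) M]

/-- The map `f : M → S⁵ ⊂ ℝ⁶` in the preferred chart at `p`. -/
noncomputable def localRep (n : ℕ) {M : Type*} [TopologicalSpace M] [ChartedSpace (EuclideanSpace ℝ (Fin n)) M]
    (f : M → S5) (p : M) (u : EuclideanSpace ℝ (Fin n)) : E6 :=
  f ((extChartAt (𝓡 n) p).symm u)

theorem contMDiff_coe_comp {f : M → S5} (hf : ContMDiff (𝓡 n) (𝓡 5) ∞ f) :
    ContMDiff (𝓡 n) 𝓘(ℝ, E6) ∞ (fun x => (f x : E6)) :=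
  haveI : Fact (Module.finrank ℝ E6 = 5 + 1) := ⟨finrank_euclideanSpace_fin⟩
  (contMDiff_coe_sphere (n := 5)).comp hf

theorem contDiffOn_localRep [IsManifold (𝓡 n) ∞ M] {f : M → S5}
    (hf : ContMDiff (𝓡 n) (𝓡 5) ∞ f) (p : M) :
    ContDiffOn ℝ ∞ (localRep n f p) (extChartAt (𝓡 n) p).target :=
  ((contMDiff_coe_comp hf).comp_contMDiffOn (contMDiffOn_extChartAt_symm p)).contDiffOn

theorem contDiffAt_localRep [IsManifold (𝓡 n) ∞ M] {f : M → S5}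
    (hf : ContMDiff (𝓡 n) (𝓡 5) ∞ f) {p : M} {u : EuclideanSpace ℝ (Fin n)}
    (hu : u ∈ (extChartAt (𝓡 n) p).target) : ContDiffAt ℝ ∞ (localRep n f p) u :=
  (contDiffOn_localRep hf p).contDiffAt ((isOpen_extChartAt_target p).mem_nhds hu)

theorem localRep_extChartAt (f : M → S5) {p q : M} (hq : q ∈ (extChartAt (𝓡 n) p).source) :
    localRep n f p (extChartAt (𝓡 n) p q) = f q := by
  rw [localRep, (extChartAt (𝓡 n) p).left_inv hq]

theorem differential_eq_fderiv {f : M → S5} (hf : ContMDiff (𝓡 n) (𝓡 5) ∞ f) (p : M) :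
    differential n f p = fderiv ℝ (localRep n f p) (extChartAt (𝓡 n) p p) := by
  rw [differential, ((contMDiff_coe_comp hf).contMDiffAt.mdifferentiableAt (by simp)).mfderiv]
  simp only [ModelWithCorners.range_eq_univ, fderivWithin_univ]
  rfl

theorem mem_normalSpace_iff {f : M → S5} (hf : ContMDiff (𝓡 n) (𝓡 5) ∞ f) {p : M} {V : E6} :
    V ∈ normalSpace n f p ↔ ⟪V, (f p : E6)⟫_ℝ = 0 ∧
      ∀ a, ⟪V, fderiv ℝ (localRep n f p) (extChartAt (𝓡 n) p p) a⟫_ℝ = 0 := by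
  rw [normalSpace, differential_eq_fderiv hf, ← Submodule.inf_orthogonal, Submodule.mem_inf,
    Submodule.mem_orthogonal_singleton_iff_inner_left, Submodule.mem_orthogonal']
  refine and_congr_right fun _ => ⟨fun h a => h _ ⟨a, rfl⟩, ?_⟩
  rintro h _ ⟨a, rfl⟩
  exact h a

/-- The orthogonal projection onto the normal space is self-adjoint and fixes `V`, so against a
normal vector it can be dropped. -/
theorem inner_secondFundamentalForm {f : M → S5} {p : M} {V : E6} (hV : V ∈ normalSpace n f p)
    (X Y : TangentSpace (𝓡 n) p) : ⟪secondFundamentalForm n f p X Y, V⟫_ℝ =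
      ⟪V, fderiv ℝ (fderiv ℝ (localRep n f p)) (extChartAt (𝓡 n) p p) X Y⟫_ℝ := by
  have h := Submodule.inner_starProjection_left_eq_right (normalSpace n f p) V
    (fderiv ℝ (fderiv ℝ (localRep n f p)) (extChartAt (𝓡 n) p p) X Y)
  rw [Submodule.starProjection_eq_self_iff.2 hV] at h
  rw [real_inner_comm, h]
  rfl

theorem inner_secondFundamentalForm' {f : M → S5} {p : M} {V : E6} (hV : V ∈ normalSpace n f p)
    (X Y : TangentSpace (𝓡 n) p) : ⟪V, secondFundamentalForm n f p X Y⟫_ℝ =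
      ⟪V, fderiv ℝ (fderiv ℝ (localRep n f p)) (extChartAt (𝓡 n) p p) X Y⟫_ℝ := by
  rw [real_inner_comm, inner_secondFundamentalForm hV]

end LocalRep

/-! ### Independence of the chart -/

section ChartChange

variable {E E' W : Type*} [NormedAddCommGroup E] [NormedSpace ℝ E]
  [NormedAddCommGroup E'] [NormedSpace ℝ E'] [NormedAddCommGroup W] [InnerProductSpace ℝ W]

/-- The last term lies in the range of the differential of `F`, so it disappears when paired with a
normal vector; this makes the second fundamental form tensorial. -/
theorem fderiv_fderiv_comp {F : E' → W} {τ : E → E'} {a : E} (hF : ContDiffAt ℝ ∞ F (τ a))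
    (hτ : ContDiffAt ℝ ∞ τ a) (X Y : E) :
    fderiv ℝ (fderiv ℝ (F ∘ τ)) a X Y =
      fderiv ℝ (fderiv ℝ F) (τ a) (fderiv ℝ τ a X) (fderiv ℝ τ a Y) +
        fderiv ℝ F (τ a) (fderiv ℝ (fderiv ℝ τ) a X Y) := by
  have hF1 : ∀ᶠ y in 𝓝 (τ a), DifferentiableAt ℝ F y :=
    ((hF.of_le (m := 1) (by simp)).eventually (by simp)).mono fun y hy => hy.differentiableAt (by simp)
  have hτ1 : ∀ᶠ x in 𝓝 a, DifferentiableAt ℝ τ x :=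
    ((hτ.of_le (m := 1) (by simp)).eventually (by simp)).mono fun y hy => hy.differentiableAt (by simp)
  have h1 : fderiv ℝ (F ∘ τ) =ᶠ[𝓝 a] fun x => (fderiv ℝ F (τ x)).comp (fderiv ℝ τ x) := by
    filter_upwards [hτ.continuousAt.eventually hF1, hτ1] with x hx hx'
    exact fderiv_comp x hx hx'
  have h2 : HasFDerivAt (fderiv ℝ F) (fderiv ℝ (fderiv ℝ F) (τ a)) (τ a) :=
    ((hF.fderiv_right (m := 1) (by norm_cast)).differentiableAt (by simp)).hasFDerivAt
  have h3 : HasFDerivAt (fderiv ℝ τ) (fderiv ℝ (fderiv ℝ τ) a) a :=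
    ((hτ.fderiv_right (m := 1) (by norm_cast)).differentiableAt (by simp)).hasFDerivAt
  have h4 : HasFDerivAt τ (fderiv ℝ τ a) a := (hτ.differentiableAt (by simp)).hasFDerivAt
  have h5 : HasFDerivAt (fun x => (fderiv ℝ F (τ x)).comp (fderiv ℝ τ x)) _ a :=
    (h2.comp a h4).clm_comp h3
  rw [h1.fderiv_eq, h5.fderiv]
  simp [add_comm]

/-- The vectors orthogonal to the image of the differential, and their pairing with the second
derivative, do not depend on the parametrization. -/
theorem normal_conditions_comp {F : E' → W} {τ : E → E'} {a : E} (hF : ContDiffAt ℝ ∞ F (τ a))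
    (hτ : ContDiffAt ℝ ∞ τ a) (hs : Surjective (fderiv ℝ τ a)) (V : W) :
    ((∀ X, ⟪V, fderiv ℝ (F ∘ τ) a X⟫_ℝ = 0) ↔ ∀ X, ⟪V, fderiv ℝ F (τ a) X⟫_ℝ = 0) ∧
    ((∀ X, ⟪V, fderiv ℝ F (τ a) X⟫_ℝ = 0) →
      ((∃ X Y, ⟪V, fderiv ℝ (fderiv ℝ (F ∘ τ)) a X Y⟫_ℝ ≠ 0) ↔
        ∃ X Y, ⟪V, fderiv ℝ (fderiv ℝ F) (τ a) X Y⟫_ℝ ≠ 0)) := by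
  constructor
  · rw [fderiv_comp a (hF.differentiableAt (by simp)) (hτ.differentiableAt (by simp))]
    exact (hs.forall (p := fun Z => ⟪V, fderiv ℝ F (τ a) Z⟫_ℝ = 0)).symm
  · intro h
    simp only [fderiv_fderiv_comp hF hτ, inner_add_right, h, add_zero]
    rw [hs.exists]
    exact exists_congr fun X => (hs.exists
      (p := fun Z => ⟪V, fderiv ℝ (fderiv ℝ F) (τ a) (fderiv ℝ τ a X) Z⟫_ℝ ≠ 0)).symm

end ChartChange

section Transition

variable {n : ℕ} {M : Type*} [TopologicalSpace M] [ChartedSpace (EuclideanSpace ℝ (Fin n)) M]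

theorem localRep_eventuallyEq_comp (f : M → S5) {p q : M} (hq : p ∈ (extChartAt (𝓡 n) q).source) :
    localRep n f p =ᶠ[𝓝 (extChartAt (𝓡 n) p p)]
      localRep n f q ∘ (extChartAt (𝓡 n) q ∘ (extChartAt (𝓡 n) p).symm) := by
  have hs : (extChartAt (𝓡 n) q).source ∈ 𝓝 ((extChartAt (𝓡 n) p).symm
      (extChartAt (𝓡 n) p p)) := by
    rw [extChartAt_to_inv]
    exact (isOpen_extChartAt_source q).mem_nhds hq
  filter_upwards [(continuousAt_extChartAt_symm p).eventually hs] with u hu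
  rw [comp_apply, comp_apply, localRep_extChartAt f hu]
  rfl

variable [IsManifold (𝓡 n) ∞ M]

theorem contDiffAt_coordChange {p q r : M} (hp : r ∈ (extChartAt (𝓡 n) p).source)
    (hq : r ∈ (extChartAt (𝓡 n) q).source) :
    ContDiffAt ℝ ∞ (extChartAt (𝓡 n) q ∘ (extChartAt (𝓡 n) p).symm) (extChartAt (𝓡 n) p r) := by
  have := contDiffWithinAt_ext_coord_change (I := 𝓡 n) (n := ∞) q p
    (y := extChartAt (𝓡 n) p r) (by
      rw [PartialEquiv.trans_source, PartialEquiv.symm_source]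
      exact ⟨(extChartAt (𝓡 n) p).map_source hp, by
        rw [mem_preimage, (extChartAt (𝓡 n) p).left_inv hp]; exact hq⟩)
  rwa [ModelWithCorners.range_eq_univ, contDiffWithinAt_univ] at this

/-- The derivative of the reverse coordinate change is a right inverse. -/
theorem fderiv_coordChange_surjective {p q r : M} (hp : r ∈ (extChartAt (𝓡 n) p).source)
    (hq : r ∈ (extChartAt (𝓡 n) q).source) :
    Surjective (fderiv ℝ (extChartAt (𝓡 n) q ∘ (extChartAt (𝓡 n) p).symm)
      (extChartAt (𝓡 n) p r)) := by
  have h1 := ((contDiffAt_coordChange hp hq).differentiableAt (by simp)).hasFDerivAt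
  have h2 := ((contDiffAt_coordChange hq hp).differentiableAt (by simp)).hasFDerivAt
  have hr : (extChartAt (𝓡 n) p ∘ (extChartAt (𝓡 n) q).symm) (extChartAt (𝓡 n) q r) =
      extChartAt (𝓡 n) p r := by
    rw [comp_apply, (extChartAt (𝓡 n) q).left_inv hq]
  rw [← hr] at h1
  have h3 := h1.comp _ h2
  have h4 : (extChartAt (𝓡 n) q ∘ (extChartAt (𝓡 n) p).symm) ∘
      (extChartAt (𝓡 n) p ∘ (extChartAt (𝓡 n) q).symm) =ᶠ[𝓝 (extChartAt (𝓡 n) q r)] id := by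
    have hc : ContinuousAt (extChartAt (𝓡 n) q).symm (extChartAt (𝓡 n) q r) :=
      continuousAt_extChartAt_symm' hq
    have hs : (extChartAt (𝓡 n) p).source ∈ 𝓝 ((extChartAt (𝓡 n) q).symm
        (extChartAt (𝓡 n) q r)) := by
      rw [(extChartAt (𝓡 n) q).left_inv hq]
      exact (isOpen_extChartAt_source p).mem_nhds hp
    filter_upwards [hc.eventually hs, (isOpen_extChartAt_target q).mem_nhds
      ((extChartAt (𝓡 n) q).map_source hq)] with u hu hu'
    simp only [comp_apply, id]
    rw [(extChartAt (𝓡 n) p).left_inv hu, (extChartAt (𝓡 n) q).right_inv hu']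
  have h5 := h3.unique ((hasFDerivAt_id _).congr_of_eventuallyEq h4)
  rw [hr] at h5
  intro X
  exact ⟨_, congr($h5 X)⟩

/-- The normal space in the preferred chart at another point. -/
theorem mem_normalSpace_iff_of_mem_source {f : M → S5} (hf : ContMDiff (𝓡 n) (𝓡 5) ∞ f) {p q : M}
    (hq : p ∈ (extChartAt (𝓡 n) q).source) {V : E6} :
    V ∈ normalSpace n f p ↔ ⟪V, localRep n f q (extChartAt (𝓡 n) q p)⟫_ℝ = 0 ∧
      ∀ a, ⟪V, fderiv ℝ (localRep n f q) (extChartAt (𝓡 n) q p) a⟫_ℝ = 0 := by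
  have hr : (extChartAt (𝓡 n) q ∘ (extChartAt (𝓡 n) p).symm) (extChartAt (𝓡 n) p p) =
      extChartAt (𝓡 n) q p := by rw [comp_apply, extChartAt_to_inv]
  have h1 := (normal_conditions_comp (F := localRep n f q)
    (by rw [hr]; exact contDiffAt_localRep hf ((extChartAt (𝓡 n) q).map_source hq))
    (contDiffAt_coordChange (mem_extChartAt_source p) hq)
    (fderiv_coordChange_surjective (mem_extChartAt_source p) hq) V).1
  rw [mem_normalSpace_iff hf, localRep_extChartAt f hq,
    (localRep_eventuallyEq_comp f hq).fderiv_eq, ← hr]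
  exact and_congr_right fun _ => h1

/-- The definition uses a different preferred chart at each point, whereas openness and smoothness
arguments need one chart for all points near `q`. -/
theorem exists_inner_secondFundamentalForm_ne_zero_iff {f : M → S5}
    (hf : ContMDiff (𝓡 n) (𝓡 5) ∞ f) {p q : M}
    (hq : p ∈ (extChartAt (𝓡 n) q).source) {V : E6} (hV : V ∈ normalSpace n f p) :
    (∃ X Y, ⟪V, secondFundamentalForm n f p X Y⟫_ℝ ≠ 0) ↔
      ∃ a b, ⟪V, fderiv ℝ (fderiv ℝ (localRep n f q)) (extChartAt (𝓡 n) q p) a b⟫_ℝ ≠ 0 := by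
  have hr : (extChartAt (𝓡 n) q ∘ (extChartAt (𝓡 n) p).symm) (extChartAt (𝓡 n) p p) =
      extChartAt (𝓡 n) q p := by rw [comp_apply, extChartAt_to_inv]
  have h1 := (normal_conditions_comp (F := localRep n f q)
    (by rw [hr]; exact contDiffAt_localRep hf ((extChartAt (𝓡 n) q).map_source hq))
    (contDiffAt_coordChange (mem_extChartAt_source p) hq)
    (fderiv_coordChange_surjective (mem_extChartAt_source p) hq) V).2
  rw [hr] at h1
  simp only [inner_secondFundamentalForm' hV]
  rw [(localRep_eventuallyEq_comp f hq).fderiv.fderiv_eq]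
  exact h1 ((mem_normalSpace_iff_of_mem_source hf hq).1 hV).2

end Transition

/-! ### Openness of `N_*` in the unit normal bundle -/

section Surface

variable {M : Type*} [TopologicalSpace M] [ChartedSpace (EuclideanSpace ℝ (Fin 2)) M]

theorem notMem_orthogonal_secondFormImage_iff (g : M → S5) (p : M) (V : E6) :
    V ∉ (secondFormImage g p)ᗮ ↔ ∃ X Y, ⟪V, secondFundamentalForm 2 g p X Y⟫_ℝ ≠ 0 := by
  rw [iff_comm, ← not_iff_not, not_not, secondFormImage, Submodule.mem_orthogonal']
  push Not
  refine ⟨fun h w hw => ?_, fun h X Y => h _ (Submodule.subset_span ⟨X, Y, rfl⟩)⟩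
  induction hw using Submodule.span_induction with
  | mem w hw => obtain ⟨X, Y, rfl⟩ := hw; exact h X Y
  | zero => simp
  | add x y _ _ hx hy => rw [inner_add_right, hx, hy, add_zero]
  | smul c x _ hx => rw [real_inner_smul_right, hx, mul_zero]

variable [IsManifold (𝓡 2) ∞ M]

theorem mem_starBundle_iff {g : M → S5} (hg : ContMDiff (𝓡 2) (𝓡 5) ∞ g) {p q : M}
    (hq : p ∈ (extChartAt (𝓡 2) q).source) {V : E6} :
    (p, V) ∈ starBundle g ↔ ‖V‖ = 1 ∧ ⟪V, localRep 2 g q (extChartAt (𝓡 2) q p)⟫_ℝ = 0 ∧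
      (∀ a, ⟪V, fderiv ℝ (localRep 2 g q) (extChartAt (𝓡 2) q p) a⟫_ℝ = 0) ∧
      ∃ a b, ⟪V, fderiv ℝ (fderiv ℝ (localRep 2 g q)) (extChartAt (𝓡 2) q p) a b⟫_ℝ ≠ 0 := by
  have h1 : (p, V) ∈ starBundle g ↔ (‖V‖ = 1 ∧ V ∈ normalSpace 2 g p) ∧
      V ∉ (secondFormImage g p)ᗮ := Iff.rfl
  rw [h1, notMem_orthogonal_secondFormImage_iff, and_assoc, and_congr_right_iff]
  intro _
  rw [← and_assoc (a := ⟪V, _⟫_ℝ = 0), ← mem_normalSpace_iff_of_mem_source hg hq,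
    and_congr_right_iff]
  exact fun hV => exists_inner_secondFundamentalForm_ne_zero_iff hg hq hV

theorem isOpen_starBundle {g : M → S5} (hg : ContMDiff (𝓡 2) (𝓡 5) ∞ g) :
    IsOpen {q : unitNormalBundle g | (q : M × E6) ∈ starBundle g} := by
  rw [isOpen_iff_mem_nhds]
  rintro ⟨⟨p, V⟩, hq⟩ hstar
  obtain ⟨h1, h2, h3, a, b, hab⟩ := (mem_starBundle_iff hg (mem_extChartAt_source p)).1 hstar
  have hsrc : ∀ᶠ q : unitNormalBundle g in 𝓝 ⟨⟨p, V⟩, hq⟩,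
      q.1.1 ∈ (extChartAt (𝓡 2) p).source :=
    (continuous_fst.comp continuous_subtype_val).continuousAt.eventually
      ((isOpen_extChartAt_source p).mem_nhds (mem_extChartAt_source p))
  have hD2 : ContinuousAt (fderiv ℝ (fderiv ℝ (localRep 2 g p))) (extChartAt (𝓡 2) p p) :=
    (((contDiffAt_localRep hg (mem_extChartAt_target p)).fderiv_right (m := ∞) (by simp)).fderiv_right
      (m := 0) (by simp)).continuousAt
  have hφ : ContinuousAt (fun q : unitNormalBundle g => extChartAt (𝓡 2) p q.1.1)
      ⟨⟨p, V⟩, hq⟩ :=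
    ContinuousAt.comp (g := extChartAt (𝓡 2) p) (continuousAt_extChartAt p)
    (continuous_fst.comp continuous_subtype_val).continuousAt
  -- With the witnesses `a`, `b` at the given point frozen, membership nearby follows from the
  -- nonvanishing of one continuous function.
  have hc : ContinuousAt (fun q : unitNormalBundle g => ⟪q.1.2, fderiv ℝ (fderiv ℝ
      (localRep 2 g p)) (extChartAt (𝓡 2) p q.1.1) a b⟫_ℝ) ⟨⟨p, V⟩, hq⟩ :=
    (continuous_snd.comp continuous_subtype_val).continuousAt.inner
      (((ContinuousAt.comp (g := fderiv ℝ (fderiv ℝ (localRep 2 g p)))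
        (f := fun q : unitNormalBundle g => extChartAt (𝓡 2) p q.1.1) hD2 hφ).clm_apply
        continuousAt_const).clm_apply continuousAt_const)
  filter_upwards [hsrc, hc.eventually_ne hab] with q hq1 hq2
  have hN := (mem_normalSpace_iff_of_mem_source hg hq1).1 q.2.2
  exact (mem_starBundle_iff hg hq1).2 ⟨q.2.1, hN.1, hN.2, a, b, hq2⟩

end Surface

end SphereImmersion

/-! ### Invertible linear maps and smooth families of them -/

theorem ContinuousLinearMap.isInvertible_of_injective {E F : Type*} [NormedAddCommGroup E]
    [NormedSpace ℝ E] [NormedAddCommGroup F] [NormedSpace ℝ F] [FiniteDimensional ℝ E]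
    [FiniteDimensional ℝ F] (A : E →L[ℝ] F) (hA : Injective A)
    (h : Module.finrank ℝ E = Module.finrank ℝ F) : A.IsInvertible :=
  ⟨(LinearEquiv.ofInjectiveOfFinrankEq (A : E →ₗ[ℝ] F) hA h).toContinuousLinearEquiv, by
    ext x; rfl⟩

theorem isOpen_setOf_isInvertible {E F : Type*} [NormedAddCommGroup E]
    [NormedSpace ℝ E] [NormedAddCommGroup F] [NormedSpace ℝ F] [CompleteSpace E] :
    IsOpen {A : E →L[ℝ] F | A.IsInvertible} :=
  ContinuousLinearEquiv.isOpen

/-- A family of continuous linear maps is `C^n` at a point if all its applications are. -/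
theorem contDiffAt_clm_apply {D E F : Type*} [NormedAddCommGroup D] [NormedSpace ℝ D]
    [NormedAddCommGroup E] [NormedSpace ℝ E] [NormedAddCommGroup F] [NormedSpace ℝ F]
    [FiniteDimensional ℝ E] {n : ℕ∞ω} {f : D → E →L[ℝ] F} {x : D}
    (h : ∀ y, ContDiffAt ℝ n (fun x => f x y) x) : ContDiffAt ℝ n f x := by
  let d := Module.finrank ℝ E
  have hd : d = Module.finrank ℝ (Fin d → ℝ) := (Module.finrank_fin_fun ℝ).symm
  let e₁ := ContinuousLinearEquiv.ofFinrankEq hd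
  let e₂ := (e₁.arrowCongr (1 : F ≃L[ℝ] F)).trans (ContinuousLinearEquiv.piRing (Fin d))
  rw [← id_comp f, ← e₂.symm_comp_self]
  exact e₂.symm.contDiff.contDiffAt.comp x (contDiffAt_pi.mpr fun i => h _)

/-! ### Parametrizing unit normals by central projection -/

namespace SphereImmersion

section NormalField

variable {W : Type*} [NormedAddCommGroup W] [InnerProductSpace ℝ W]

/-- The linear map whose kernel conditions single out the normal space of the surface `G` in the
sphere, completed by the coordinates `⟪V₀, ·⟫` and `T` to an isomorphism near a given point. -/
noncomputable def frameMap (G : EuclideanSpace ℝ (Fin 2) → W) (V₀ : W)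
    (T : W →L[ℝ] EuclideanSpace ℝ (Fin 2)) (u : EuclideanSpace ℝ (Fin 2)) :
    W →L[ℝ] ℝ × (Fin 2 → ℝ) × ℝ × EuclideanSpace ℝ (Fin 2) :=
  (innerSL ℝ (G u)).prod ((ContinuousLinearMap.pi fun i =>
    innerSL ℝ (fderiv ℝ G u (EuclideanSpace.single i 1))).prod ((innerSL ℝ V₀).prod T))

/-- The normal vector with affine coordinates `y` in the frame. -/
noncomputable def affineNormal (G : EuclideanSpace ℝ (Fin 2) → W) (V₀ : W)
    (T : W →L[ℝ] EuclideanSpace ℝ (Fin 2))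
    (p : EuclideanSpace ℝ (Fin 2) × EuclideanSpace ℝ (Fin 2)) : W :=
  (frameMap G V₀ T p.1).inverse (0, 0, 1, p.2)

/-- The unit normal vector with projective coordinates `y` in the frame. -/
noncomputable def unitNormal (G : EuclideanSpace ℝ (Fin 2) → W) (V₀ : W)
    (T : W →L[ℝ] EuclideanSpace ℝ (Fin 2))
    (p : EuclideanSpace ℝ (Fin 2) × EuclideanSpace ℝ (Fin 2)) : W :=
  ‖affineNormal G V₀ T p‖⁻¹ • affineNormal G V₀ T p

variable {G : EuclideanSpace ℝ (Fin 2) → W} {V₀ : W} {T : W →L[ℝ] EuclideanSpace ℝ (Fin 2)}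
  {u y : EuclideanSpace ℝ (Fin 2)}

theorem frameMap_affineNormal (hA : (frameMap G V₀ T u).IsInvertible) :
    frameMap G V₀ T u (affineNormal G V₀ T (u, y)) = (0, 0, 1, y) := by
  obtain ⟨e, he⟩ := hA
  rw [affineNormal, ← he, ContinuousLinearMap.inverse_equiv]
  exact e.apply_symm_apply _

theorem forall_inner_eq_zero_iff {L : EuclideanSpace ℝ (Fin 2) →L[ℝ] W} {V : W} :
    (∀ a, ⟪V, L a⟫_ℝ = 0) ↔ ∀ i, ⟪L (EuclideanSpace.single i 1), V⟫_ℝ = 0 := by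
  refine ⟨fun h i => by rw [real_inner_comm, h], fun h a => ?_⟩
  have ha : a = a 0 • EuclideanSpace.single 0 1 + a 1 • EuclideanSpace.single 1 1 := by
    ext i; fin_cases i <;> simp
  rw [ha, map_add, map_smul, map_smul, inner_add_right, real_inner_smul_right,
    real_inner_smul_right, real_inner_comm, h, real_inner_comm, h]
  simp

theorem frameMap_apply (V : W) : frameMap G V₀ T u V = (⟪G u, V⟫_ℝ,
    (fun i => ⟪fderiv ℝ G u (EuclideanSpace.single i 1), V⟫_ℝ), ⟪V₀, V⟫_ℝ, T V) := rfl

theorem affineNormal_spec (hA : (frameMap G V₀ T u).IsInvertible) :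
    ⟪affineNormal G V₀ T (u, y), G u⟫_ℝ = 0 ∧
      (∀ a, ⟪affineNormal G V₀ T (u, y), fderiv ℝ G u a⟫_ℝ = 0) ∧
      ⟪V₀, affineNormal G V₀ T (u, y)⟫_ℝ = 1 ∧ T (affineNormal G V₀ T (u, y)) = y := by
  have h := frameMap_affineNormal (y := y) hA
  rw [frameMap_apply] at h
  simp only [Prod.mk.injEq] at h
  exact ⟨by rw [real_inner_comm, h.1], forall_inner_eq_zero_iff.2 (congrFun h.2.1), h.2.2⟩

theorem affineNormal_ne_zero (hA : (frameMap G V₀ T u).IsInvertible) :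
    affineNormal G V₀ T (u, y) ≠ 0 := fun h0 => by
  have := (affineNormal_spec (y := y) hA).2.2.1
  simp [h0] at this

theorem norm_unitNormal (hA : (frameMap G V₀ T u).IsInvertible) :
    ‖unitNormal G V₀ T (u, y)‖ = 1 := by
  rw [unitNormal, norm_smul, norm_inv, norm_norm]
  exact inv_mul_cancel₀ (norm_ne_zero_iff.2 (affineNormal_ne_zero hA))

theorem inner_unitNormal_base (hA : (frameMap G V₀ T u).IsInvertible) :
    ⟪unitNormal G V₀ T (u, y), G u⟫_ℝ = 0 := by
  rw [unitNormal, real_inner_smul_left, (affineNormal_spec hA).1, mul_zero]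

theorem inner_unitNormal_fderiv (hA : (frameMap G V₀ T u).IsInvertible)
    (a : EuclideanSpace ℝ (Fin 2)) : ⟪unitNormal G V₀ T (u, y), fderiv ℝ G u a⟫_ℝ = 0 := by
  rw [unitNormal, real_inner_smul_left, (affineNormal_spec hA).2.1, mul_zero]

theorem inner_unitNormal_pos (hA : (frameMap G V₀ T u).IsInvertible) :
    0 < ⟪V₀, unitNormal G V₀ T (u, y)⟫_ℝ := by
  rw [unitNormal, real_inner_smul_right, (affineNormal_spec hA).2.2.1, mul_one]
  exact inv_pos.2 (norm_pos_iff.2 (affineNormal_ne_zero hA))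

/-- The quotient is unchanged under scaling, so the normalization of the affine normal does not
affect it. -/
theorem coord_unitNormal (hA : (frameMap G V₀ T u).IsInvertible) :
    (⟪V₀, unitNormal G V₀ T (u, y)⟫_ℝ)⁻¹ • T (unitNormal G V₀ T (u, y)) = y := by
  have h0 := norm_ne_zero_iff.2 (affineNormal_ne_zero (y := y) hA)
  rw [unitNormal, real_inner_smul_right, (affineNormal_spec hA).2.2.1, map_smul,
    (affineNormal_spec hA).2.2.2, smul_smul, mul_one, inv_inv, mul_inv_cancel₀ h0, one_smul]

/-- The rescaled vector `V / ⟪V₀, V⟫` solves the linear system defining the affine normal, hence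
equals it; positivity of `⟪V₀, V⟫` makes normalization return `V` and not `-V`. -/
theorem unitNormal_coord (hA : (frameMap G V₀ T u).IsInvertible) {V : W} (hV : ‖V‖ = 1)
    (h1 : ⟪V, G u⟫_ℝ = 0) (h2 : ∀ a, ⟪V, fderiv ℝ G u a⟫_ℝ = 0) (h3 : 0 < ⟪V₀, V⟫_ℝ) :
    unitNormal G V₀ T (u, (⟪V₀, V⟫_ℝ)⁻¹ • T V) = V := by
  have hw : affineNormal G V₀ T (u, (⟪V₀, V⟫_ℝ)⁻¹ • T V) = (⟪V₀, V⟫_ℝ)⁻¹ • V := by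
    obtain ⟨e, he⟩ := id hA
    apply e.injective
    rw [← ContinuousLinearEquiv.coe_coe, he, frameMap_affineNormal hA, frameMap_apply]
    simp only [inner_smul_right, forall_inner_eq_zero_iff.1 h2, real_inner_comm V (G u), h1,
      mul_zero, inv_mul_cancel₀ h3.ne', map_smul]
    rfl
  rw [unitNormal, hw, norm_smul, hV, mul_one, norm_inv, Real.norm_of_nonneg h3.le, inv_inv,
    smul_smul, mul_inv_cancel₀ h3.ne', one_smul]

variable [FiniteDimensional ℝ W]

theorem contDiffAt_frameMap (hG : ContDiffAt ℝ ∞ G u) : ContDiffAt ℝ ∞ (frameMap G V₀ T) u := by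
  refine contDiffAt_clm_apply fun V => ?_
  simp only [frameMap_apply]
  have hd : ContDiffAt ℝ ∞ (fderiv ℝ G) u := hG.fderiv_right (by simp)
  refine (hG.inner ℝ contDiffAt_const).prodMk (ContDiffAt.prodMk ?_ contDiffAt_const)
  rw [contDiffAt_pi]
  exact fun i => (hd.clm_apply contDiffAt_const).inner ℝ contDiffAt_const

theorem contDiffAt_unitNormal (hG : ContDiffAt ℝ ∞ G u)
    (hA : (frameMap G V₀ T u).IsInvertible) :
    ContDiffAt ℝ ∞ (unitNormal G V₀ T) (u, y) := by
  have h1 : ContDiffAt ℝ ∞ (affineNormal G V₀ T) (u, y) := by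
    have hA1 : ContDiffAt ℝ ∞ (fun p : EuclideanSpace ℝ (Fin 2) × EuclideanSpace ℝ (Fin 2) =>
        frameMap G V₀ T p.1) (u, y) := (contDiffAt_frameMap hG).comp (u, y) contDiffAt_fst
    obtain ⟨e, he⟩ := hA
    have hinv : ContDiffAt ℝ ∞ ContinuousLinearMap.inverse (frameMap G V₀ T u) := by
      rw [← he]; exact contDiffAt_map_inverse e
    exact (hinv.comp (u, y) hA1).clm_apply (contDiffAt_const.prodMk
      (contDiffAt_const.prodMk (contDiffAt_const.prodMk contDiffAt_snd)))
  have h0 := affineNormal_ne_zero (y := y) hA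
  exact ((h1.norm ℝ h0).inv (norm_ne_zero_iff.2 h0)).smul h1

/-- At a point where `G` is an immersion into the unit sphere with unit normal `V₀`, the coordinate
`⟪V₀, ·⟫` can be completed to coordinates on the normal spaces near that point. -/
theorem exists_frameMap_isInvertible (hW : Module.finrank ℝ W = 6) (hG : ‖G u‖ = 1)
    (hG' : ∀ a, ⟪G u, fderiv ℝ G u a⟫_ℝ = 0) (hinj : Injective (fderiv ℝ G u)) (hV₀ : ‖V₀‖ = 1)
    (h1 : ⟪V₀, G u⟫_ℝ = 0) (h2 : ∀ a, ⟪V₀, fderiv ℝ G u a⟫_ℝ = 0) :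
    ∃ T : W →L[ℝ] EuclideanSpace ℝ (Fin 2), T V₀ = 0 ∧ (frameMap G V₀ T u).IsInvertible := by
  -- The vectors `V₀`, `G u` and the tangent plane span dimension four; the two missing coordinates
  -- are supplied by the projection onto the orthogonal plane `Sᗮ`.
  let S : Submodule ℝ W := ((ℝ ∙ V₀) ⊔ (ℝ ∙ G u)) ⊔ (fderiv ℝ G u).range
  have hVS : V₀ ∈ S := Submodule.mem_sup_left (Submodule.mem_sup_left
    (Submodule.mem_span_singleton_self V₀))
  have hGS : G u ∈ S := Submodule.mem_sup_left (Submodule.mem_sup_right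
    (Submodule.mem_span_singleton_self _))
  have hDS : ∀ a, fderiv ℝ G u a ∈ S := fun a => Submodule.mem_sup_right ⟨a, rfl⟩
  have hV0 : V₀ ≠ 0 := norm_ne_zero_iff.1 (by rw [hV₀]; exact one_ne_zero)
  have hG0 : G u ≠ 0 := norm_ne_zero_iff.1 (by rw [hG]; exact one_ne_zero)
  have ho1 : (ℝ ∙ V₀) ⟂ (ℝ ∙ G u) := by
    rw [Submodule.isOrtho_span]
    rintro _ rfl _ rfl; exact h1
  have ho2 : ((ℝ ∙ V₀) ⊔ (ℝ ∙ G u)) ⟂ (fderiv ℝ G u).range := by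
    rw [Submodule.isOrtho_sup_left, Submodule.isOrtho_iff_inner_eq, Submodule.isOrtho_iff_inner_eq]
    constructor
    · rintro v hv _ ⟨a, rfl⟩
      obtain ⟨c, rfl⟩ := Submodule.mem_span_singleton.1 hv
      rw [real_inner_smul_left]; exact mul_eq_zero_of_right _ (h2 a)
    · rintro v hv _ ⟨a, rfl⟩
      obtain ⟨c, rfl⟩ := Submodule.mem_span_singleton.1 hv
      rw [real_inner_smul_left]; exact mul_eq_zero_of_right _ (hG' a)
  have hS : Module.finrank ℝ S = 4 := by
    have e1 := Submodule.finrank_sup_add_finrank_inf_eq (ℝ ∙ V₀) (ℝ ∙ G u)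
    have e2 := Submodule.finrank_sup_add_finrank_inf_eq ((ℝ ∙ V₀) ⊔ (ℝ ∙ G u))
      (fderiv ℝ G u).range
    have hr : Module.finrank ℝ (fderiv ℝ G u).range = 2 :=
      (LinearMap.finrank_range_of_inj hinj).trans finrank_euclideanSpace_fin
    rw [ho1.disjoint.eq_bot, finrank_bot, finrank_span_singleton hV0,
      finrank_span_singleton hG0] at e1
    rw [ho2.disjoint.eq_bot, finrank_bot, hr] at e2
    change Module.finrank ℝ S + 0 = _ at e2
    omega
  have hK : Module.finrank ℝ Sᗮ = Module.finrank ℝ (EuclideanSpace ℝ (Fin 2)) := by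
    have := Submodule.finrank_add_finrank_orthogonal S
    rw [finrank_euclideanSpace_fin]; omega
  let j : Sᗮ ≃L[ℝ] EuclideanSpace ℝ (Fin 2) :=
    (LinearEquiv.ofFinrankEq _ _ hK).toContinuousLinearEquiv
  let T : W →L[ℝ] EuclideanSpace ℝ (Fin 2) :=
    (j : Sᗮ →L[ℝ] EuclideanSpace ℝ (Fin 2)).comp Sᗮ.orthogonalProjectionOnto
  refine ⟨T, ?_, ContinuousLinearMap.isInvertible_of_injective _
    ((injective_iff_map_eq_zero _).2 fun w hw => ?_) ?_⟩
  · have : Sᗮ.orthogonalProjectionOnto V₀ = 0 :=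
      Submodule.orthogonalProjectionOnto_orthogonal_apply_eq_zero hVS
    simp [T, this]
  · rw [frameMap_apply] at hw
    simp only [Prod.mk_eq_zero] at hw
    obtain ⟨w1, w2, w3, w4⟩ := hw
    have w2' : ∀ a, ⟪w, fderiv ℝ G u a⟫_ℝ = 0 := forall_inner_eq_zero_iff.2 (congrFun w2)
    have hwK : w ∈ Sᗮ := by
      rw [Submodule.mem_orthogonal']
      intro s hs
      obtain ⟨a, ha, _, ⟨b, rfl⟩, rfl⟩ := Submodule.mem_sup.1 hs
      obtain ⟨c, hc, d, hd, rfl⟩ := Submodule.mem_sup.1 ha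
      obtain ⟨c, rfl⟩ := Submodule.mem_span_singleton.1 hc
      obtain ⟨d, rfl⟩ := Submodule.mem_span_singleton.1 hd
      rw [inner_add_right, inner_add_right, real_inner_smul_right, real_inner_smul_right,
        real_inner_comm, w3, real_inner_comm, w1]
      simpa using w2' b
    have h5 : Sᗮ.orthogonalProjectionOnto w = 0 := by simpa [T] using w4
    have h6 := Submodule.orthogonalProjectionOnto_mem_subspace_eq_self (K := Sᗮ) ⟨w, hwK⟩
    rw [show ((⟨w, hwK⟩ : Sᗮ) : W) = w from rfl, h5] at h6
    exact (congrArg Subtype.val h6).symm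
  · simp [hW]

end NormalField

end SphereImmersion

/-! ### Charts and smooth structure of `N_*` -/

namespace SphereImmersion

section Chart

variable {M : Type*} [TopologicalSpace M] [ChartedSpace (EuclideanSpace ℝ (Fin 2)) M]

/-- The coordinates on the normal spaces near `q.1.1` complementing `⟪q.1.2, ·⟫`. -/
noncomputable def frameProj (g : M → S5) (q : starBundle g) :
    E6 →L[ℝ] EuclideanSpace ℝ (Fin 2) :=
  Classical.epsilon fun T => T q.1.2 = 0 ∧
    (frameMap (localRep 2 g q.1.1) q.1.2 T (extChartAt (𝓡 2) q.1.1 q.1.1)).IsInvertible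

/-- The frame isomorphism near `q`. -/
noncomputable def frameAt (g : M → S5) (q : starBundle g) (u : EuclideanSpace ℝ (Fin 2)) :
    E6 →L[ℝ] ℝ × (Fin 2 → ℝ) × ℝ × EuclideanSpace ℝ (Fin 2) :=
  frameMap (localRep 2 g q.1.1) q.1.2 (frameProj g q) u

/-- The unit normal field near `q`, as a function of four coordinates. -/
noncomputable def normalAt (g : M → S5) (q : starBundle g) (z : EuclideanSpace ℝ (Fin 4)) : E6 :=
  unitNormal (localRep 2 g q.1.1) q.1.2 (frameProj g q) (splitCoord z)

/-- The coordinates of the chart of `N_*` at `q`. -/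
noncomputable def starCoord (g : M → S5) (q r : starBundle g) : EuclideanSpace ℝ (Fin 4) :=
  splitCoord.symm (extChartAt (𝓡 2) q.1.1 r.1.1, (⟪q.1.2, r.1.2⟫_ℝ)⁻¹ • frameProj g q r.1.2)

open Classical in
/-- The inverse of the chart of `N_*` at `q`. -/
noncomputable def starInv (g : M → S5) (q : starBundle g) (z : EuclideanSpace ℝ (Fin 4)) :
    starBundle g :=
  -- The fallback `q` only makes the function total; on `starTarget g q` the first branch always
  -- applies.
  if h : ((extChartAt (𝓡 2) q.1.1).symm (baseCoord z), normalAt g q z) ∈ starBundle g then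
    ⟨_, h⟩ else q

/-- The domain of the base coordinates of the chart of `N_*` at `q`. -/
def frameDomain (g : M → S5) (q : starBundle g) : Set (EuclideanSpace ℝ (Fin 2)) :=
  (extChartAt (𝓡 2) q.1.1).target ∩ {u | (frameAt g q u).IsInvertible}

/-- The source of the chart of `N_*` at `q`. -/
def starSource (g : M → S5) (q : starBundle g) : Set (starBundle g) :=
  {r | r.1.1 ∈ (extChartAt (𝓡 2) q.1.1).source ∧
    extChartAt (𝓡 2) q.1.1 r.1.1 ∈ frameDomain g q ∧ 0 < ⟪q.1.2, r.1.2⟫_ℝ}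

/-- The target of the chart of `N_*` at `q`. -/
def starTarget (g : M → S5) (q : starBundle g) : Set (EuclideanSpace ℝ (Fin 4)) :=
  {z | baseCoord z ∈ frameDomain g q ∧
    ∃ a b, ⟪normalAt g q z, fderiv ℝ (fderiv ℝ (localRep 2 g q.1.1)) (baseCoord z) a b⟫_ℝ ≠ 0}

theorem inner_localRep_self {n : ℕ} {M : Type*} [TopologicalSpace M]
    [ChartedSpace (EuclideanSpace ℝ (Fin n)) M] (f : M → S5) (p : M)
    (u : EuclideanSpace ℝ (Fin n)) : ⟪localRep n f p u, localRep n f p u⟫_ℝ = 1 := by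
  rw [real_inner_self_eq_norm_sq, localRep, norm_eq_of_mem_sphere, one_pow]

variable [IsManifold (𝓡 2) ∞ M] {g : M → S5}

theorem frameProj_spec (hg : ContMDiff (𝓡 2) (𝓡 5) ∞ g)
    (hinj : ∀ p, Injective (differential 2 g p)) (q : starBundle g) :
    frameProj g q q.1.2 = 0 ∧ (frameAt g q (extChartAt (𝓡 2) q.1.1 q.1.1)).IsInvertible := by
  obtain ⟨h1, h2, h3, -⟩ := (mem_starBundle_iff hg (mem_extChartAt_source q.1.1)).1 q.2
  have hF := ((contDiffAt_localRep hg (mem_extChartAt_target q.1.1)).differentiableAt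
    (by simp)).hasFDerivAt
  have hn : ‖localRep 2 g q.1.1 (extChartAt (𝓡 2) q.1.1 q.1.1)‖ = 1 := norm_eq_of_mem_sphere _
  refine Classical.epsilon_spec (exists_frameMap_isInvertible finrank_euclideanSpace_fin hn
    (fun a => ?_) ?_ h1 h2 h3)
  · have := inner_fderiv_add_eq_zero hF hF (Filter.Eventually.of_forall
      (inner_localRep_self g q.1.1)) a
    rw [real_inner_comm (localRep 2 g q.1.1 _)] at this
    linarith
  · rw [← differential_eq_fderiv hg]; exact hinj q.1.1

theorem contDiffAt_frameAt (hg : ContMDiff (𝓡 2) (𝓡 5) ∞ g) (q : starBundle g)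
    {u : EuclideanSpace ℝ (Fin 2)} (hu : u ∈ (extChartAt (𝓡 2) q.1.1).target) :
    ContDiffAt ℝ ∞ (frameAt g q) u :=
  contDiffAt_frameMap (contDiffAt_localRep hg hu)

theorem isOpen_frameDomain (hg : ContMDiff (𝓡 2) (𝓡 5) ∞ g) (q : starBundle g) :
    IsOpen (frameDomain g q) :=
  ContinuousOn.isOpen_inter_preimage (f := frameAt g q)
    (fun _ hu => (contDiffAt_frameAt hg q hu).continuousAt.continuousWithinAt)
    (isOpen_extChartAt_target _) isOpen_setOf_isInvertible

theorem contDiffAt_normalAt (hg : ContMDiff (𝓡 2) (𝓡 5) ∞ g) (q : starBundle g)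
    {z : EuclideanSpace ℝ (Fin 4)} (hz : baseCoord z ∈ frameDomain g q) :
    ContDiffAt ℝ ∞ (normalAt g q) z :=
  (contDiffAt_unitNormal (y := fibreCoord z) (contDiffAt_localRep hg hz.1) hz.2).comp z
    splitCoord.contDiff.contDiffAt

theorem continuousAt_fderiv_fderiv_localRep (hg : ContMDiff (𝓡 2) (𝓡 5) ∞ g) (p : M)
    {u : EuclideanSpace ℝ (Fin 2)} (hu : u ∈ (extChartAt (𝓡 2) p).target) :
    ContinuousAt (fderiv ℝ (fderiv ℝ (localRep 2 g p))) u :=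
  (((contDiffAt_localRep hg hu).fderiv_right (m := ∞) (by simp)).fderiv_right
    (m := 0) (by simp)).continuousAt

theorem isOpen_starTarget (hg : ContMDiff (𝓡 2) (𝓡 5) ∞ g) (q : starBundle g) :
    IsOpen (starTarget g q) := by
  rw [isOpen_iff_mem_nhds]
  rintro z ⟨hz, a, b, hab⟩
  have hc : ContinuousAt (fun w => ⟪normalAt g q w,
      fderiv ℝ (fderiv ℝ (localRep 2 g q.1.1)) (baseCoord w) a b⟫_ℝ) z :=
    (contDiffAt_normalAt hg q hz).continuousAt.inner
      (((ContinuousAt.comp (f := baseCoord) (continuousAt_fderiv_fderiv_localRep hg q.1.1 hz.1)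
        baseCoord.continuous.continuousAt).clm_apply continuousAt_const).clm_apply
        continuousAt_const)
  filter_upwards [hc.eventually_ne hab, ((isOpen_frameDomain hg q).preimage
    baseCoord.continuous).mem_nhds hz] with w h1 h2
  exact ⟨h2, a, b, h1⟩

theorem isOpen_starSource (hg : ContMDiff (𝓡 2) (𝓡 5) ∞ g) (q : starBundle g) :
    IsOpen (starSource g q) := by
  have h1 : IsOpen ((extChartAt (𝓡 2) q.1.1).source ∩
      extChartAt (𝓡 2) q.1.1 ⁻¹' frameDomain g q) :=
    (continuousOn_extChartAt q.1.1).isOpen_inter_preimage (isOpen_extChartAt_source _)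
      (isOpen_frameDomain hg q)
  have h2 : IsOpen {r : starBundle g | 0 < ⟪q.1.2, r.1.2⟫_ℝ} :=
    isOpen_lt continuous_const
      (continuous_const.inner (continuous_snd.comp continuous_subtype_val))
  have h3 := (h1.preimage (continuous_fst.comp
    (continuous_subtype_val (p := (· ∈ starBundle g))))).inter h2
  convert h3 using 1
  ext r
  exact ⟨fun h => ⟨⟨h.1, h.2.1⟩, h.2.2⟩, fun h => ⟨h.1.1, h.1.2, h.2⟩⟩

theorem mem_starBundle_of_mem_starTarget (hg : ContMDiff (𝓡 2) (𝓡 5) ∞ g) {q : starBundle g}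
    {z : EuclideanSpace ℝ (Fin 4)} (hz : z ∈ starTarget g q) :
    ((extChartAt (𝓡 2) q.1.1).symm (baseCoord z), normalAt g q z) ∈ starBundle g := by
  rw [mem_starBundle_iff hg ((extChartAt (𝓡 2) q.1.1).map_target hz.1.1),
    (extChartAt (𝓡 2) q.1.1).right_inv hz.1.1]
  exact ⟨norm_unitNormal hz.1.2, inner_unitNormal_base hz.1.2, inner_unitNormal_fderiv hz.1.2,
    hz.2⟩

theorem coe_starInv (hg : ContMDiff (𝓡 2) (𝓡 5) ∞ g) {q : starBundle g}
    {z : EuclideanSpace ℝ (Fin 4)} (hz : z ∈ starTarget g q) :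
    (starInv g q z : M × E6) =
      ((extChartAt (𝓡 2) q.1.1).symm (baseCoord z), normalAt g q z) := by
  rw [starInv, dif_pos (mem_starBundle_of_mem_starTarget hg hz)]

theorem normalAt_starCoord (hg : ContMDiff (𝓡 2) (𝓡 5) ∞ g) {q r : starBundle g}
    (hr : r ∈ starSource g q) : normalAt g q (starCoord g q r) = r.1.2 := by
  obtain ⟨h1, h2, h3, -⟩ := (mem_starBundle_iff hg hr.1).1 r.2
  rw [normalAt, starCoord, splitCoord.apply_symm_apply]
  exact unitNormal_coord hr.2.1.2 h1 h2 h3 hr.2.2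

theorem starCoord_mem_starTarget (hg : ContMDiff (𝓡 2) (𝓡 5) ∞ g) {q r : starBundle g}
    (hr : r ∈ starSource g q) : starCoord g q r ∈ starTarget g q := by
  have hb : baseCoord (starCoord g q r) = extChartAt (𝓡 2) q.1.1 r.1.1 :=
    baseCoord_splitCoord_symm _
  refine ⟨by rw [hb]; exact hr.2.1, ?_⟩
  rw [normalAt_starCoord hg hr, hb]
  exact ((mem_starBundle_iff hg hr.1).1 r.2).2.2.2

theorem starInv_starCoord (hg : ContMDiff (𝓡 2) (𝓡 5) ∞ g) {q r : starBundle g}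
    (hr : r ∈ starSource g q) : starInv g q (starCoord g q r) = r := by
  have hb : baseCoord (starCoord g q r) = extChartAt (𝓡 2) q.1.1 r.1.1 :=
    baseCoord_splitCoord_symm _
  refine Subtype.ext ?_
  rw [coe_starInv hg (starCoord_mem_starTarget hg hr), normalAt_starCoord hg hr, hb,
    (extChartAt (𝓡 2) q.1.1).left_inv hr.1]

theorem starInv_mem_starSource (hg : ContMDiff (𝓡 2) (𝓡 5) ∞ g) {q : starBundle g}
    {z : EuclideanSpace ℝ (Fin 4)} (hz : z ∈ starTarget g q) :
    starInv g q z ∈ starSource g q := by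
  refine ⟨?_, ?_, ?_⟩
  · rw [coe_starInv hg hz]
    exact (extChartAt (𝓡 2) q.1.1).map_target hz.1.1
  · rw [coe_starInv hg hz, (extChartAt (𝓡 2) q.1.1).right_inv hz.1.1]
    exact hz.1
  · rw [coe_starInv hg hz]
    exact inner_unitNormal_pos hz.1.2

theorem starCoord_starInv (hg : ContMDiff (𝓡 2) (𝓡 5) ∞ g) {q : starBundle g}
    {z : EuclideanSpace ℝ (Fin 4)} (hz : z ∈ starTarget g q) :
    starCoord g q (starInv g q z) = z := by
  rw [starCoord, coe_starInv hg hz, (extChartAt (𝓡 2) q.1.1).right_inv hz.1.1,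
    ContinuousLinearEquiv.symm_apply_eq, splitCoord_apply]
  exact Prod.ext rfl (coord_unitNormal hz.1.2)

/-- The chart of `N_*` at `q`. -/
noncomputable def starChart (hg : ContMDiff (𝓡 2) (𝓡 5) ∞ g) (q : starBundle g) :
    OpenPartialHomeomorph (starBundle g) (EuclideanSpace ℝ (Fin 4)) where
  toFun := starCoord g q
  invFun := starInv g q
  source := starSource g q
  target := starTarget g q
  map_source' _ hr := starCoord_mem_starTarget hg hr
  map_target' _ hz := starInv_mem_starSource hg hz
  left_inv' _ hr := starInv_starCoord hg hr
  right_inv' _ hz := starCoord_starInv hg hz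
  open_source := isOpen_starSource hg q
  open_target := isOpen_starTarget hg q
  continuousOn_toFun := by
    have hV : Continuous fun r : starBundle g => r.1.2 :=
      continuous_snd.comp continuous_subtype_val
    have hi : Continuous fun r : starBundle g => ⟪q.1.2, r.1.2⟫_ℝ := continuous_const.inner hV
    refine splitCoord.symm.continuous.comp_continuousOn (ContinuousOn.prodMk ?_ ?_)
    · exact (continuousOn_extChartAt q.1.1).comp
        (continuous_fst.comp continuous_subtype_val).continuousOn fun r hr => hr.1
    · exact (hi.continuousOn.inv₀ fun r hr => hr.2.2.ne').smul
        ((frameProj g q).continuous.comp hV).continuousOn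
  continuousOn_invFun := by
    rw [Topology.IsInducing.subtypeVal.continuousOn_iff]
    have hc : ContinuousOn (fun z => ((extChartAt (𝓡 2) q.1.1).symm (baseCoord z),
        normalAt g q z)) (starTarget g q) :=
      ((continuousOn_extChartAt_symm q.1.1).comp baseCoord.continuous.continuousOn
        fun z hz => hz.1.1).prodMk
        fun z hz => (contDiffAt_normalAt hg q hz.1).continuousAt.continuousWithinAt
    exact hc.congr fun z hz => coe_starInv hg hz

theorem mem_starSource_self (hg : ContMDiff (𝓡 2) (𝓡 5) ∞ g)
    (hinj : ∀ p, Injective (differential 2 g p)) (q : starBundle g) : q ∈ starSource g q := by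
  refine ⟨mem_extChartAt_source _, ⟨mem_extChartAt_target _, (frameProj_spec hg hinj q).2⟩, ?_⟩
  rw [real_inner_self_eq_norm_sq, q.2.1.1]
  norm_num

/-- The smooth structure of `N_*`. -/
@[reducible]
noncomputable def starChartedSpace (hg : ContMDiff (𝓡 2) (𝓡 5) ∞ g)
    (hinj : ∀ p, Injective (differential 2 g p)) :
    ChartedSpace (EuclideanSpace ℝ (Fin 4)) (starBundle g) where
  atlas := range (starChart hg)
  chartAt := starChart hg
  mem_chart_source := mem_starSource_self hg hinj
  chart_mem_atlas := mem_range_self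

/-- The inverse chart is given by smooth base and normal components, and `starCoord g r` is a smooth
expression in them as long as the denominator `⟪r.1.2, ·⟫` is nonzero, which the source guarantees.
-/
theorem starChart_transition (hg : ContMDiff (𝓡 2) (𝓡 5) ∞ g) (q r : starBundle g) :
    ContDiffOn ℝ ∞ (starCoord g r ∘ starInv g q)
      (starTarget g q ∩ starInv g q ⁻¹' starSource g r) := by
  rintro z ⟨hz, hr⟩
  have hN := contDiffAt_normalAt hg q hz.1
  have hp : (starInv g q z).1.1 = (extChartAt (𝓡 2) q.1.1).symm (baseCoord z) := by
    rw [coe_starInv hg hz]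
  have hV : (starInv g q z).1.2 = normalAt g q z := by rw [coe_starInv hg hz]
  have h0 : ⟪r.1.2, normalAt g q z⟫_ℝ ≠ 0 := by
    rw [← hV]; exact hr.2.2.ne'
  have hbase : ContDiffAt ℝ ∞ (fun w => extChartAt (𝓡 2) r.1.1
      ((extChartAt (𝓡 2) q.1.1).symm (baseCoord w))) z := by
    have hsq := (extChartAt (𝓡 2) q.1.1).map_target hz.1.1
    have := contDiffAt_coordChange (n := 2) hsq (q := r.1.1) (by rw [← hp]; exact hr.1)
    rw [(extChartAt (𝓡 2) q.1.1).right_inv hz.1.1] at this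
    exact this.comp z baseCoord.contDiff.contDiffAt
  have h1 : ContDiffAt ℝ ∞ (fun w => splitCoord.symm (extChartAt (𝓡 2) r.1.1
      ((extChartAt (𝓡 2) q.1.1).symm (baseCoord w)),
      (⟪r.1.2, normalAt g q w⟫_ℝ)⁻¹ • frameProj g r (normalAt g q w))) z :=
    splitCoord.symm.contDiff.contDiffAt.comp z (hbase.prodMk
      (((contDiffAt_const.inner ℝ hN).inv h0).smul
        ((frameProj g r).contDiff.contDiffAt.comp z hN)))
  refine (h1.congr_of_eventuallyEq ?_).contDiffWithinAt
  filter_upwards [(isOpen_starTarget hg q).mem_nhds hz] with w hw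
  rw [comp_apply, starCoord, coe_starInv hg hw]

theorem isManifold_starBundle (hg : ContMDiff (𝓡 2) (𝓡 5) ∞ g)
    (hinj : ∀ p, Injective (differential 2 g p)) :
    letI := starChartedSpace hg hinj
    IsManifold (𝓡 4) ∞ (starBundle g) := by
  let := starChartedSpace hg hinj
  refine isManifold_of_contDiffOn (𝓡 4) ∞ (starBundle g) ?_
  rintro _ _ ⟨q, rfl⟩ ⟨r, rfl⟩
  have h := starChart_transition hg q r
  simpa using! h.mono (by intro z hz; simpa using! hz)

end Chart

end SphereImmersion

/-! ### Geometry of the polar map -/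

namespace SphereImmersion

section Surface

variable {M : Type*} [TopologicalSpace M] [ChartedSpace (EuclideanSpace ℝ (Fin 2)) M]

theorem baseCoord_starCoord (g : M → S5) (q r : starBundle g) :
    baseCoord (starCoord g q r) = extChartAt (𝓡 2) q.1.1 r.1.1 :=
  baseCoord_splitCoord_symm _

variable [IsManifold (𝓡 2) ∞ M] {g : M → S5}

theorem isPolarPair_normalAt (hg : ContMDiff (𝓡 2) (𝓡 5) ∞ g)
    (hinj : ∀ p, Injective (differential 2 g p)) (q : starBundle g) :
    IsPolarPair (localRep 2 g q.1.1) (normalAt g q) (starCoord g q q) := by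
  have hq := mem_starSource_self hg hinj q
  have hdom : ∀ᶠ w in 𝓝 (starCoord g q q), baseCoord w ∈ frameDomain g q :=
    ((isOpen_frameDomain hg q).preimage baseCoord.continuous).mem_nhds
      (starCoord_mem_starTarget hg hq).1
  refine ⟨?_, hdom.mono fun w hw => contDiffAt_normalAt hg q hw,
    .of_forall (inner_localRep_self g q.1.1), hdom.mono fun w hw => ?_,
    hdom.mono fun w hw => inner_unitNormal_base hw.2,
    hdom.mono fun w hw => inner_unitNormal_fderiv hw.2,
    -- The central projection itself serves as the retraction that reads the fibre coordinates off
    -- `V`.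
    fun V => (⟪q.1.2, V⟫_ℝ)⁻¹ • frameProj g q V, ?_, hdom.mono fun w hw => coord_unitNormal hw.2⟩
  · rw [baseCoord_starCoord]
    filter_upwards [(isOpen_extChartAt_target q.1.1).mem_nhds (mem_extChartAt_target q.1.1)]
      with u hu using contDiffAt_localRep hg hu
  · rw [real_inner_self_eq_norm_sq, normalAt, splitCoord_apply, norm_unitNormal hw.2, one_pow]
  · rw [normalAt_starCoord hg hq]
    have h0 : ⟪q.1.2, q.1.2⟫_ℝ ≠ 0 := hq.2.2.ne'
    exact ((differentiableAt_const _).inner ℝ differentiableAt_id).inv h0 |>.smul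
      (frameProj g q).differentiableAt

theorem form_isPolarPair_normalAt (hg : ContMDiff (𝓡 2) (𝓡 5) ∞ g)
    (hinj : ∀ p, Injective (differential 2 g p)) (q : starBundle g)
    (X Y : EuclideanSpace ℝ (Fin 2)) : (isPolarPair_normalAt hg hinj q).form X Y =
      ⟪q.1.2, secondFundamentalForm 2 g q.1.1 X Y⟫_ℝ := by
  rw [IsPolarPair.form_apply, normalAt_starCoord hg (mem_starSource_self hg hinj q),
    baseCoord_starCoord]
  exact (inner_secondFundamentalForm' q.2.1.2 X Y).symm

theorem firstFormMatrix_eq_gramMatrix {n : ℕ} {N : Type*} [TopologicalSpace N]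
    [ChartedSpace (EuclideanSpace ℝ (Fin n)) N] {f : N → S5} (hf : ContMDiff (𝓡 n) (𝓡 5) ∞ f)
    (p : N) : firstFormMatrix n f p =
      gramMatrix (fderiv ℝ (localRep n f p) (extChartAt (𝓡 n) p p)) := by
  rw [← differential_eq_fderiv hf]; rfl

/-- The vanishing mean curvature vector of `g`, paired with the normal `q.1.2`. -/
theorem trace_form_eq_zero (hg : ContMDiff (𝓡 2) (𝓡 5) ∞ g)
    (hinj : ∀ p, Injective (differential 2 g p)) (hmin : ∀ p, meanCurvatureVector 2 g p = 0)
    (q : starBundle g) : ∑ i, ∑ j,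
      (gramMatrix (fderiv ℝ (localRep 2 g q.1.1) (baseCoord (starCoord g q q))))⁻¹ i j *
        (isPolarPair_normalAt hg hinj q).form (EuclideanSpace.single i 1)
          (EuclideanSpace.single j 1) = 0 := by
  have h := hmin q.1.1
  rw [meanCurvatureVector, smul_eq_zero, or_iff_right (by norm_num)] at h
  have h2 := congrArg (fun w => ⟪q.1.2, w⟫_ℝ) h
  simp only [inner_sum, inner_zero_right, real_inner_smul_right] at h2
  rw [baseCoord_starCoord, ← firstFormMatrix_eq_gramMatrix hg, ← h2]
  refine Finset.sum_congr rfl fun i _ => Finset.sum_congr rfl fun j _ => ?_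
  rw [form_isPolarPair_normalAt hg hinj]
  rfl

/-- Here the removal of the normals orthogonal to the image of the second fundamental form enters.
-/
theorem exists_form_ne_zero (hg : ContMDiff (𝓡 2) (𝓡 5) ∞ g)
    (hinj : ∀ p, Injective (differential 2 g p)) (q : starBundle g) :
    ∃ X Y, (isPolarPair_normalAt hg hinj q).form X Y ≠ 0 := by
  obtain ⟨X, Y, h⟩ := (notMem_orthogonal_secondFormImage_iff g q.1.1 q.1.2).1 q.2.2
  exact ⟨X, Y, (form_isPolarPair_normalAt hg hinj q X Y).trans_ne h⟩

theorem fderiv_normalAt_injective (hg : ContMDiff (𝓡 2) (𝓡 5) ∞ g)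
    (hinj : ∀ p, Injective (differential 2 g p)) (hmin : ∀ p, meanCurvatureVector 2 g p = 0)
    (q : starBundle g) : Injective (fderiv ℝ (normalAt g q) (starCoord g q q)) := by
  have h := isPolarPair_normalAt hg hinj q
  refine h.fderiv_normal_injective (h.form_det_ne_zero ?_ (trace_form_eq_zero hg hinj hmin q)
    (exists_form_ne_zero hg hinj q))
  rw [baseCoord_starCoord, ← differential_eq_fderiv hg]
  exact hinj q.1.1

section SmoothStructure

theorem contMDiff_fst_starBundle (hg : ContMDiff (𝓡 2) (𝓡 5) ∞ g)
    (hinj : ∀ p, Injective (differential 2 g p)) :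
    letI := starChartedSpace hg hinj
    ContMDiff (𝓡 4) (𝓡 2) ∞ fun r : starBundle g => r.1.1 := by
  let := starChartedSpace hg hinj
  have := isManifold_starBundle hg hinj
  intro q
  have hq := mem_starSource_self hg hinj q
  have h1 : ContMDiffAt (𝓡 4) 𝓘(ℝ, EuclideanSpace ℝ (Fin 4)) ∞ (starCoord g q) q :=
    contMDiffAt_extChartAt (x := q)
  have h2 : ContMDiffAt 𝓘(ℝ, EuclideanSpace ℝ (Fin 2)) (𝓡 2) ∞ (extChartAt (𝓡 2) q.1.1).symm
      (baseCoord (starCoord g q q)) :=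
    (contMDiffOn_extChartAt_symm q.1.1).contMDiffAt ((isOpen_extChartAt_target q.1.1).mem_nhds
      (starCoord_mem_starTarget hg hq).1.1)
  have h3 := h2.comp q ((baseCoord.contMDiff.contMDiffAt (x := starCoord g q q)).comp q h1)
  refine h3.congr_of_eventuallyEq ?_
  filter_upwards [(isOpen_starSource hg q).mem_nhds hq] with r hr
  rw [comp_apply, comp_apply, baseCoord_starCoord, (extChartAt (𝓡 2) q.1.1).left_inv hr.1]

theorem contMDiff_snd_starBundle (hg : ContMDiff (𝓡 2) (𝓡 5) ∞ g)
    (hinj : ∀ p, Injective (differential 2 g p)) :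
    letI := starChartedSpace hg hinj
    ContMDiff (𝓡 4) 𝓘(ℝ, E6) ∞ fun r : starBundle g => r.1.2 := by
  let := starChartedSpace hg hinj
  have := isManifold_starBundle hg hinj
  intro q
  have hq := mem_starSource_self hg hinj q
  have h1 : ContMDiffAt (𝓡 4) 𝓘(ℝ, EuclideanSpace ℝ (Fin 4)) ∞ (starCoord g q) q :=
    contMDiffAt_extChartAt (x := q)
  have h2 : ContMDiffAt 𝓘(ℝ, EuclideanSpace ℝ (Fin 4)) 𝓘(ℝ, E6) ∞ (normalAt g q)
      (starCoord g q q) :=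
    (contDiffAt_normalAt hg q (starCoord_mem_starTarget hg hq).1).contMDiffAt
  refine (h2.comp q h1).congr_of_eventuallyEq ?_
  filter_upwards [(isOpen_starSource hg q).mem_nhds hq] with r hr
  rw [comp_apply, normalAt_starCoord hg hr]

theorem contMDiff_polarMap (hg : ContMDiff (𝓡 2) (𝓡 5) ∞ g)
    (hinj : ∀ p, Injective (differential 2 g p)) :
    letI := starChartedSpace hg hinj
    ContMDiff (𝓡 4) (𝓡 5) ∞ (polarMap g) := by
  let := starChartedSpace hg hinj
  have := isManifold_starBundle hg hinj
  have : Fact (Module.finrank ℝ E6 = 5 + 1) := ⟨finrank_euclideanSpace_fin⟩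
  exact (contMDiff_snd_starBundle hg hinj).codRestrict_sphere (n := 5)
    fun q => mem_sphere_zero_iff_norm.2 q.2.1.1

theorem localRep_polarMap_eventuallyEq (hg : ContMDiff (𝓡 2) (𝓡 5) ∞ g)
    (hinj : ∀ p, Injective (differential 2 g p)) (q : starBundle g) :
    letI := starChartedSpace hg hinj
    localRep 4 (polarMap g) q =ᶠ[𝓝 (starCoord g q q)] normalAt g q := by
  let := starChartedSpace hg hinj
  filter_upwards [(isOpen_starTarget hg q).mem_nhds
    (starCoord_mem_starTarget hg (mem_starSource_self hg hinj q))] with z hz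
  exact congrArg Prod.snd (coe_starInv hg hz)

theorem differential_polarMap (hg : ContMDiff (𝓡 2) (𝓡 5) ∞ g)
    (hinj : ∀ p, Injective (differential 2 g p)) (q : starBundle g) :
    letI := starChartedSpace hg hinj
    differential 4 (polarMap g) q = fderiv ℝ (normalAt g q) (starCoord g q q) := by
  let := starChartedSpace hg hinj
  rw [differential_eq_fderiv (contMDiff_polarMap hg hinj)]
  exact (localRep_polarMap_eventuallyEq hg hinj q).fderiv_eq

theorem normalSpace_polarMap (hg : ContMDiff (𝓡 2) (𝓡 5) ∞ g)
    (hinj : ∀ p, Injective (differential 2 g p)) (hmin : ∀ p, meanCurvatureVector 2 g p = 0)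
    (q : starBundle g) :
    letI := starChartedSpace hg hinj
    normalSpace 4 (polarMap g) q = ℝ ∙ (g q.1.1 : E6) := by
  let := starChartedSpace hg hinj
  have h := (isPolarPair_normalAt hg hinj q).orthogonal_eq_span finrank_euclideanSpace_fin
    (fderiv_normalAt_injective hg hinj hmin q)
  rw [normalAt_starCoord hg (mem_starSource_self hg hinj q), baseCoord_starCoord,
    localRep_extChartAt g (mem_extChartAt_source q.1.1), ← differential_polarMap hg hinj q] at h
  exact h

/-- The normal space is the line of the unit vector `g q.1.1`, so the projection is determined by
one inner product, which the local calculus has computed. -/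
theorem secondFundamentalForm_polarMap (hg : ContMDiff (𝓡 2) (𝓡 5) ∞ g)
    (hinj : ∀ p, Injective (differential 2 g p)) (hmin : ∀ p, meanCurvatureVector 2 g p = 0)
    (q : starBundle g) (X Y : EuclideanSpace ℝ (Fin 4)) :
    letI := starChartedSpace hg hinj
    secondFundamentalForm 4 (polarMap g) q X Y =
      (isPolarPair_normalAt hg hinj q).form (baseCoord X) (baseCoord Y) • (g q.1.1 : E6) := by
  let := starChartedSpace hg hinj
  have h := isPolarPair_normalAt hg hinj q
  have h1 : secondFundamentalForm 4 (polarMap g) q X Y = (normalSpace 4 (polarMap g) q).starProjection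
      (fderiv ℝ (fderiv ℝ (normalAt g q)) (starCoord g q q) X Y) := by
    rw [← (localRep_polarMap_eventuallyEq hg hinj q).fderiv.fderiv_eq]
    rfl
  have h2 := h.inner_fderiv_fderiv_normal_base X Y
  rw [← h.form_apply, h.form_symm, baseCoord_starCoord,
    localRep_extChartAt g (mem_extChartAt_source q.1.1), real_inner_comm] at h2
  simp only [h1, normalSpace_polarMap hg hinj hmin q]
  rw [Submodule.starProjection_unit_singleton ℝ (norm_eq_of_mem_sphere (g q.1.1)), h2]

theorem isMinimalImmersion_polarMap (hg : ContMDiff (𝓡 2) (𝓡 5) ∞ g)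
    (hinj : ∀ p, Injective (differential 2 g p)) (hmin : ∀ p, meanCurvatureVector 2 g p = 0) :
    letI := starChartedSpace hg hinj
    IsMinimalImmersion 4 (polarMap g) := by
  let := starChartedSpace hg hinj
  have := isManifold_starBundle hg hinj
  have : Fact (Module.finrank ℝ E6 = 5 + 1) := ⟨finrank_euclideanSpace_fin⟩
  have hsm := contMDiff_polarMap hg hinj
  -- The complement has dimension one because the hypersurface has dimension `4` in `S⁵`.
  refine ⟨⟨EuclideanSpace ℝ (Fin 1), inferInstance, inferInstance, fun q => ?_⟩, fun q => ?_⟩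
  · refine Manifold.isImmersionAtOfComplement_of_injective_mfderiv (by simp) hsm ?_ (by simp)
    have h1 := fderiv_normalAt_injective hg hinj hmin q
    rw [← differential_polarMap hg hinj q] at h1
    have h2 : differential 4 (polarMap g) q =
        (mfderiv (𝓡 5) 𝓘(ℝ, E6) ((↑) : S5 → E6) (polarMap g q)).comp
          (mfderiv (𝓡 4) (𝓡 5) (polarMap g) q) :=
      mfderiv_comp q ((contMDiff_coe_sphere (n := 5) (m := 1)).mdifferentiableAt (by simp))
        (hsm.mdifferentiableAt (by simp))
    rw [h2] at h1
    exact Injective.of_comp h1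
  · have h := (isPolarPair_normalAt hg hinj q).trace_form_normal_eq_zero
      finrank_euclideanSpace_fin (by
        rw [baseCoord_starCoord, ← differential_eq_fderiv hg]; exact hinj q.1.1)
      (trace_form_eq_zero hg hinj hmin q) (exists_form_ne_zero hg hinj q)
    rw [← differential_polarMap hg hinj q] at h
    have h3 : ∀ i j, secondFundamentalForm 4 (polarMap g) q (coordVec 4 q i) (coordVec 4 q j) =
        (isPolarPair_normalAt hg hinj q).form (baseCoord (EuclideanSpace.single i 1))
          (baseCoord (EuclideanSpace.single j 1)) • (g q.1.1 : E6) :=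
      fun i j => secondFundamentalForm_polarMap hg hinj hmin q _ _
    simp only [meanCurvatureVector, h3, smul_smul, ← Finset.sum_smul]
    exact smul_eq_zero_of_left (mul_eq_zero_of_right _ h) _

/-- The last two coordinate vectors are fibre directions, which the second fundamental form
annihilates; the last two columns of the shape matrix therefore vanish for every `ν`. -/
theorem rMeanCurvature_polarMap (hg : ContMDiff (𝓡 2) (𝓡 5) ∞ g)
    (hinj : ∀ p, Injective (differential 2 g p)) (hmin : ∀ p, meanCurvatureVector 2 g p = 0)
    (q : starBundle g) (ν : E6) {r : ℕ} (hr : 3 ≤ r) :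
    letI := starChartedSpace hg hinj
    rMeanCurvature 4 r (polarMap g) q ν = 0 := by
  let := starChartedSpace hg hinj
  have h3 : ∀ i (j : Fin 2), secondFundamentalForm 4 (polarMap g) q (coordVec 4 q i)
      (coordVec 4 q (Fin.natAdd 2 j)) = 0 := fun i j => by
    have := secondFundamentalForm_polarMap hg hinj hmin q (EuclideanSpace.single i 1)
      (EuclideanSpace.single (Fin.natAdd 2 j) 1)
    rw [baseCoord_single_natAdd, map_zero, zero_smul] at this
    exact this
  rw [rMeanCurvature, principalCurvatures, Matrix.esymm_roots_charpoly_eq_zero _ hr, zero_div]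
  intro i j
  simp only [shapeMatrix, Matrix.mul_apply, Matrix.of_apply, h3, inner_zero_left, mul_zero,
    Finset.sum_const_zero]

/-- Following the inclusion by the projection to `ℝ⁶` gives the polar map, so the inclusion inherits
an injective differential. The charts are continuous for the subspace topology, which makes the
embedding property immediate; the complement has dimension `2 + 6 - 4`. -/
theorem isSmoothEmbedding_starBundle (hg : ContMDiff (𝓡 2) (𝓡 5) ∞ g)
    (hinj : ∀ p, Injective (differential 2 g p)) (hmin : ∀ p, meanCurvatureVector 2 g p = 0) :
    letI := starChartedSpace hg hinj
    Manifold.IsSmoothEmbedding (𝓡 4) ((𝓡 2).prod 𝓘(ℝ, E6)) ∞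
      (Subtype.val : starBundle g → M × E6) := by
  let := starChartedSpace hg hinj
  have := isManifold_starBundle hg hinj
  have hsm : ContMDiff (𝓡 4) ((𝓡 2).prod 𝓘(ℝ, E6)) ∞ (Subtype.val : starBundle g → M × E6) :=
    (contMDiff_fst_starBundle hg hinj).prodMk (contMDiff_snd_starBundle hg hinj)
  refine ⟨⟨EuclideanSpace ℝ (Fin 4), inferInstance, inferInstance, fun q => ?_⟩, .subtypeVal⟩
  refine Manifold.isImmersionAtOfComplement_of_injective_mfderiv (by simp) hsm ?_ (by simp)
  have h1 := fderiv_normalAt_injective hg hinj hmin q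
  rw [← differential_polarMap hg hinj q] at h1
  have h2 : differential 4 (polarMap g) q =
      (mfderiv ((𝓡 2).prod 𝓘(ℝ, E6)) 𝓘(ℝ, E6) (Prod.snd : M × E6 → E6) q.1).comp
        (mfderiv (𝓡 4) ((𝓡 2).prod 𝓘(ℝ, E6)) (Subtype.val : starBundle g → M × E6) q) :=
    mfderiv_comp q mdifferentiableAt_snd (hsm.mdifferentiableAt (by simp))
  rw [h2] at h1
  exact Injective.of_comp h1

end SmoothStructure

theorem differential_injective_of_isImmersion (hg : Manifold.IsImmersion (𝓡 2) (𝓡 5) ∞ g) (p : M) :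
    Injective (differential 2 g p) := by
  have : Fact (Module.finrank ℝ E6 = 5 + 1) := ⟨finrank_euclideanSpace_fin⟩
  have h : differential 2 g p = (mfderiv (𝓡 5) 𝓘(ℝ, E6) ((↑) : S5 → E6) (g p)).comp
      (mfderiv (𝓡 2) (𝓡 5) g p) :=
    mfderiv_comp p ((contMDiff_coe_sphere (n := 5) (m := 1)).mdifferentiableAt (by simp))
      (hg.contMDiff.mdifferentiableAt (by simp))
  rw [h]
  have h2 : Injective (mfderiv (𝓡 5) 𝓘(ℝ, E6) ((↑) : S5 → E6) (g p)) :=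
    injective_mvfderiv_subtypeVal_sphere (g p)
  exact h2.comp ((hg.isImmersionOfComplement_complement p).mfderiv_injective (by simp))

end Surface

end SphereImmersion

open SphereImmersion
theorem theorem1 {M : Type*} [TopologicalSpace M] [ChartedSpace (EuclideanSpace ℝ (Fin 2)) M]
    [IsManifold (𝓡 2) ∞ M] (g : M → S5) (hg : IsMinimalImmersion 2 g)
    (hB : ∀ p : M, ∃ X Y : TangentSpace (𝓡 2) p, secondFundamentalForm 2 g p X Y ≠ 0) :
    -- `N_*` is open in `N`
    IsOpen {q : unitNormalBundle g | (q : M × E6) ∈ starBundle g} ∧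
    -- `N_*` is a smooth four-dimensional embedded submanifold of `M × ℝ⁶`
    ∃ _ : ChartedSpace (EuclideanSpace ℝ (Fin 4)) (starBundle g),
      IsManifold (𝓡 4) ∞ (starBundle g) ∧
      Manifold.IsSmoothEmbedding (𝓡 4) ((𝓡 2).prod 𝓘(ℝ, E6)) ∞
        (Subtype.val : starBundle g → M × E6) ∧
      -- for this structure `x_g` is a minimal immersion into `S⁵`
      IsMinimalImmersion 4 (polarMap g) ∧
      -- with vanishing Gauss–Kronecker and 3-mean curvatures (for either unit normal)
      ∀ (q : starBundle g) (ν : E6), ‖ν‖ = 1 → ν ∈ normalSpace 4 (polarMap g) q →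
        gaussKroneckerCurvature 4 (polarMap g) q ν = 0 ∧
        rMeanCurvature 4 3 (polarMap g) q ν = 0 := by
  have hsm := hg.1.contMDiff
  have hinj := differential_injective_of_isImmersion hg.1
  exact ⟨isOpen_starBundle hsm, starChartedSpace hsm hinj, isManifold_starBundle hsm hinj,
    isSmoothEmbedding_starBundle hsm hinj hg.2, isMinimalImmersion_polarMap hsm hinj hg.2,
    fun q ν _ _ => ⟨rMeanCurvature_polarMap hsm hinj hg.2 q ν (by norm_num),
      rMeanCurvature_polarMap hsm hinj hg.2 q ν le_rfl⟩⟩
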